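/- \textbf{Theorem (relative encoding).} Let $G$ be a graph with vertices $v_1,\dots,v_n$, $n\ge 1$, and let $d\ge 0$ be an integer. Let $F(G,d)$ be the CNF formula defined below. Then (i) $F(G,d)$ is satisfiable if and only if $\mathrm{tww}(G)\le d$; (ii) $F(G,d)$ can be constructed in time polynomial in $n+d$: there are a single random access machine (unit cost; arithmetic operations only addition and truncated subtraction) and a polynomial $B$ such that, for all such $G$ and $d$, the machine, given $n$, $d$ and the adjacency matrix of $G$, halts after at most $B(n+d)$ steps and outputs a list of the clauses of $F(G,d)$, each written as a list of its literals (order is irrelevant, repetitions are allowed). \emph{Twin-width.} A trigraph is a graph whose edges are partitioned into black and red ones; a graph is a trigraph with only black edges. $N(x)$ is the set of all neighbours of $x$ (black or red). Contracting two distinct vertices $u,v$ of a trigraph merges them into one vertex $w$; a vertex $x\ne u,v$ becomes a red neighbour of $w$ if $x\in N(u)\mathbin{\triangle}N(v)$, a black neighbour if it is a black neighbour of both $u$ and $v$, and a red neighbour if it is any other element of $N(u)\cap N(v)$; all edges not incident with $u$ or $v$ are unchanged. A $d$-sequence of $G$ is a sequence of trigraphs of maximum red degree at most $d$ that starts with $G$,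 ends with a one-vertex trigraph, and in which each trigraph after the first is a contraction of the one before it. $\mathrm{tww}(G)$ is the least $d$ for which $G$ has a $d$-sequence. \emph{The formula.} Indices $i,j,k,m$ range over $\{1,\dots,n\}$. The variables are $a_{i,j},o_{i,j},p_{i,j}$ for $i<j$, $r_{i,j,k}$ for $j<k$ and all $i$, and the auxiliary variables of the totalizers. Put $o^*_{i,j}=o_{i,j}$ if $i<j$ and $o^*_{i,j}=\neg o_{j,i}$ if $i>j$; $a^*_{i,j}=a_{\min(i,j),\max(i,j)}$ for $i\neq j$; $r^*_{i,j,k}=r_{i,\min(j,k),\max(j,k)}$ for $j\ne k$. The clauses of $F(G,d)$ are: \begin{enumerate} \item $\neg o^*_{i,j}\vee\neg o^*_{j,k}\vee o^*_{i,k}$ for mutually distinct $i,j,k$; \item $\bigvee_{j>i}p_{i,j}$ for $i<n$; $\ \neg p_{i,j}\vee\neg p_{i,k}$ for $i<j$, $i<k$, $j\ne k$; $\ \neg p_{i,j}\vee o^*_{i,j}$ for $i<j$; \item $\neg o^*_{i,j}\vee\neg o^*_{i,k}\vee\neg r^*_{i,j,k}\vee a^*_{j,k}$ for mutually distinct $i,j,k$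 with $i<j$; \item $\neg p_{i,j}\vee\neg o^*_{i,k}\vee r^*_{i,j,k}$ for $i<j$ and $v_k\in(N_G(v_i)\mathbin{\triangle}N_G(v_j))\setminus\{v_i,v_j\}$; \item $\neg p_{i,j}\vee\neg o^*_{i,k}\vee\neg a^*_{i,k}\vee r^*_{i,j,k}$ for mutually distinct $i,j,k$ with $i<j$; \item $\neg o^*_{i,j}\vee\neg o^*_{j,k}\vee\neg o^*_{j,m}\vee\neg r^*_{i,k,m}\vee r^*_{j,k,m}$ for mutually distinct $i,j,k,m$ with $k<m$; \item for all $i\ne j$, the totalizer constraint, with its own auxiliary variables, that at most $d$ of the $n-1$ literals $r^*_{i,j,k}$ ($k\neq j$, in increasing order of $k$) are true. \end{enumerate} The totalizer constraint ``at most $d$ of $x_1,\dots,x_N$'' uses the binary tree whose root is the list $x_1,\dots,x_N$ and in which a node with $\ell\ge2$ literals has as children its first $\lfloor \ell/2\rfloor$ and its last $\lceil \ell/2\rceil$ literals. A node with $\ell\geq 2$ literals has $\ell$ fresh output variables $c_1,\dots,c_\ell$; the only output of a leaf is its literal. If a node has outputs $c_1,\dots,c_\ell$ and its children have outputs $a_1,\dots,a_{\ell_1}$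 and $b_1,\dots,b_{\ell_2}$, the clauses are $\neg a_\alpha\vee\neg b_\beta\vee c_{\alpha+\beta}$ and $a_{\alpha+1}\vee b_{\beta+1}\vee\neg c_{\alpha+\beta+1}$ for $0\le\alpha\le \ell_1$, $0\le\beta\le \ell_2$, where outputs with index $0$ stand for true and outputs with index exceeding the number of outputs stand for false (false literals are deleted, and clauses containing a true literal are omitted). In addition there are the unit clauses $\neg c_s$, $d<s\le N$, for the outputs of the root. -/

import Mathlib

open scoped symmDiff

/-! ## Trigraphs and twin-width -/

/-- A trigraph: its edge set is partitioned into black and red edges. -/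
structure Trigraph (V : Type) where
  black : SimpleGraph V
  red : SimpleGraph V
  disjoint : Disjoint black red

namespace Trigraph

/-- An ordinary graph, seen as a trigraph all of whose edges are black. -/
def ofGraph {V : Type} (G : SimpleGraph V) : Trigraph V where
  black := G
  red := ⊥
  disjoint := disjoint_bot_right

/-- The neighbours of a vertex, along black or red edges. -/
def nbrs {V : Type} (T : Trigraph V) (v : V) : Set V :=
  {x | T.black.Adj v x ∨ T.red.Adj v x}

/-- Every vertex has red degree at most `d`. -/
def IsDTrigraph {V : Type} (d : ℕ) (T : Trigraph V) : Prop :=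
  ∀ v : V, {x | T.red.Adj v x}.encard ≤ d

/-- `T'` arises from `T` by contracting two distinct vertices `u`, `v` into one vertex `w`. The map
`f` sends each vertex of `T` to the vertex of `T'` that it becomes, so `w = f u = f v`, and all
other vertices are kept. -/
def IsContraction {V V' : Type} (T : Trigraph V) (T' : Trigraph V') : Prop :=
  ∃ (u v : V) (f : V → V'), u ≠ v ∧ Function.Surjective f ∧
    (∀ x y, f x = f y ↔ x = y ∨ ((x = u ∨ x = v) ∧ (y = u ∨ y = v))) ∧
    (∀ x y, x ≠ u → x ≠ v → y ≠ u → y ≠ v →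
      (T'.black.Adj (f x) (f y) ↔ T.black.Adj x y) ∧
      (T'.red.Adj (f x) (f y) ↔ T.red.Adj x y)) ∧
    (∀ x, x ≠ u → x ≠ v →
      (T'.black.Adj (f u) (f x) ↔ T.black.Adj u x ∧ T.black.Adj v x) ∧
      (T'.red.Adj (f u) (f x) ↔
        x ∈ T.nbrs u ∆ T.nbrs v ∨
        (x ∈ T.nbrs u ∩ T.nbrs v ∧ ¬ (T.black.Adj u x ∧ T.black.Adj v x))))

/-- `T` is the first member of a sequence of `d`-trigraphs, each of which (except the first) is a
contraction of the one before it, that ends in a trigraph on a single vertex. -/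
inductive HasDSequence (d : ℕ) : {V : Type} → Trigraph V → Prop
  | single {V : Type} (T : Trigraph V) :
      Nat.card V = 1 → IsDTrigraph d T → HasDSequence d T
  | contract {V V' : Type} (T : Trigraph V) (T' : Trigraph V') :
      IsDTrigraph d T → IsContraction T T' → HasDSequence d T' → HasDSequence d T

end Trigraph

/-- The twin-width of a graph with at least one vertex. -/
noncomputable def twinWidth {n : ℕ} (G : SimpleGraph (Fin n)) : ℕ :=
  sInf {d | Trigraph.HasDSequence d (Trigraph.ofGraph G)}

/-! ## Propositional formulas in conjunctive normal form -/

/-- A literal: a variable (`pos = true`) or a negated variable (`pos = false`). -/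
structure Literal (X : Type) where
  var : X
  pos : Bool

namespace Literal

/-- The negation of a literal. -/
def neg {X : Type} (l : Literal X) : Literal X := ⟨l.var, !l.pos⟩

/-- The literal `l` is true under the assignment `τ`. -/
def Holds {X : Type} (τ : X → Bool) (l : Literal X) : Prop := τ l.var = l.pos

end Literal

/-- A clause is a disjunction of literals, given by the set of these literals. -/
abbrev Clause (X : Type) := Set (Literal X)

/-- A formula in conjunctive normal form, given by the set of its clauses. -/
abbrev CNF (X : Type) := Set (Clause X)

/-- Some assignment makes at least one literal of every clause true. -/
def CNF.Satisfiable {X : Type} (F : CNF X) : Prop :=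
  ∃ τ : X → Bool, ∀ C ∈ F, ∃ l ∈ C, l.Holds τ

/-! ## Totalizer cardinality constraints

The inputs are the `m` literals `x 0, …, x (m - 1)`. A node of the balanced binary totalizer tree
is an interval `[lo, lo + len)` of input positions. It has `len` outputs, numbered `1, …, len`;
output `s` says that at least `s` of the inputs in the interval are true. The output of a leaf is the
input literal itself, and `t lo len s` is the variable for output `s` of an inner node. -/

namespace Totalizer

/-- The nodes `(lo, len)` of the tree: a node with `len ≥ 2` inputs has the first `len / 2` of them
in its left child and the rest in its right child. -/
inductive IsNode (m : ℕ) : ℕ → ℕ → Prop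
  | root : IsNode m 0 m
  | left (lo len : ℕ) : IsNode m lo len → 2 ≤ len → IsNode m lo (len / 2)
  | right (lo len : ℕ) : IsNode m lo len → 2 ≤ len → IsNode m (lo + len / 2) (len - len / 2)

variable {X : Type} (x : ℕ → Literal X) (t : ℕ → ℕ → ℕ → X)

/-- Output number `s` of a node, for `1 ≤ s ≤ len`. -/
def output (lo len s : ℕ) : Literal X := if len = 1 then x lo else ⟨t lo len s, true⟩

/-- Output `s` as a part of a clause, for `1 ≤ s`; for `s > len` it is the constant false. -/
def posPart (lo len s : ℕ) : Set (Literal X) :=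
  {l | s ≤ len ∧ l = output x t lo len s}

/-- The negation of output `s` as a part of a clause, for `s ≤ len`; output `0` is the constant
true, and so its negation is the constant false. -/
def negPart (lo len s : ℕ) : Set (Literal X) :=
  {l | 1 ≤ s ∧ l = (output x t lo len s).neg}

/-- If at least `α` inputs on the left and at least `β` inputs on the right are true, then at least
`α + β` inputs are true. -/
def upClauses (lo len : ℕ) : CNF X :=
  {C | ∃ α β, α ≤ len / 2 ∧ β ≤ len - len / 2 ∧ 1 ≤ α + β ∧
    C = negPart x t lo (len / 2) α ∪ negPart x t (lo + len / 2) (len - len / 2) β ∪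
      {output x t lo len (α + β)}}

/-- If at most `α` inputs on the left and at most `β` inputs on the right are true, then at most
`α + β` inputs are true. -/
def downClauses (lo len : ℕ) : CNF X :=
  {C | ∃ α β, α ≤ len / 2 ∧ β ≤ len - len / 2 ∧ α + β < len ∧
    C = posPart x t lo (len / 2) (α + 1) ∪ posPart x t (lo + len / 2) (len - len / 2) (β + 1) ∪
      {(output x t lo len (α + β + 1)).neg}}

/-- The totalizer constraint "at most `d` of the literals `x 0, …, x (m - 1)` are true". -/
def atMost (m d : ℕ) : CNF X :=
  {C | ∃ lo len, IsNode m lo len ∧ 2 ≤ len ∧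
    (C ∈ upClauses x t lo len ∨ C ∈ downClauses x t lo len)} ∪
  {C | ∃ s, d < s ∧ s ≤ m ∧ C = {(output x t 0 m s).neg}}

end Totalizer

/-! ## The relative encoding

The vertices `v₁, …, vₙ` are the elements `0, …, n - 1` of `Fin n`. -/

/-- The variables of the relative encoding. -/
inductive RelVar
  /-- `vᵢ vⱼ` is an edge of some graph of the elimination sequence (`i < j`) -/
  | a (i j : ℕ)
  /-- `vᵢ` precedes `vⱼ` in the elimination ordering (`i < j`) -/
  | o (i j : ℕ)
  /-- `vⱼ` is the parent of `vᵢ` in the contraction tree (`i < j`) -/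
  | p (i j : ℕ)
  /-- `vⱼ vₖ` is a (red) edge after the elimination of `vᵢ` (`j < k`) -/
  | r (i j k : ℕ)
  /-- output `s` of the inner node `[lo, lo + len)` of the totalizer that belongs to `(vᵢ, vⱼ)` -/
  | t (i j lo len s : ℕ)

namespace RelEncoding

/-- `o*ᵢⱼ`, the literal for "`vᵢ` precedes `vⱼ`". -/
def oStar (i j : ℕ) : Literal RelVar := if i < j then ⟨.o i j, true⟩ else ⟨.o j i, false⟩

/-- `a*ᵢⱼ = a*ⱼᵢ`. -/
def aStar (i j : ℕ) : Literal RelVar := if i < j then ⟨.a i j, true⟩ else ⟨.a j i, true⟩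

/-- `r*ᵢⱼₖ = r*ᵢₖⱼ`. -/
def rStar (i j k : ℕ) : Literal RelVar := if j < k then ⟨.r i j k, true⟩ else ⟨.r i k j, true⟩

/-- The literal `pᵢⱼ`. -/
def pLit (i j : ℕ) : Literal RelVar := ⟨.p i j, true⟩

variable {n : ℕ}

/-- The ordering is transitive. -/
def transitivity (n : ℕ) : CNF RelVar :=
  {C | ∃ i j k : Fin n, i ≠ j ∧ i ≠ k ∧ j ≠ k ∧
    C = {(oStar i j).neg, (oStar j k).neg, oStar i k}}

/-- Every vertex but the last one has at least one parent. -/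
def atLeastOneParent (n : ℕ) : CNF RelVar :=
  {C | ∃ i : Fin n, (i : ℕ) + 1 < n ∧ C = {l | ∃ j : Fin n, i < j ∧ l = pLit i j}}

/-- Every vertex has at most one parent. -/
def atMostOneParent (n : ℕ) : CNF RelVar :=
  {C | ∃ i j k : Fin n, i < j ∧ i < k ∧ j ≠ k ∧ C = {(pLit i j).neg, (pLit i k).neg}}

/-- Every vertex precedes its parent. -/
def parentLater (n : ℕ) : CNF RelVar :=
  {C | ∃ i j : Fin n, i < j ∧ C = {(pLit i j).neg, oStar i j}}

/-- The semantics of the auxiliary variables `a`. -/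
def auxiliary (n : ℕ) : CNF RelVar :=
  {C | ∃ i j k : Fin n, i ≠ j ∧ i ≠ k ∧ j ≠ k ∧ i < j ∧
    C = {(oStar i j).neg, (oStar i k).neg, (rStar i j k).neg, aStar j k}}

/-- Red edges that are created by a vertex and its parent having different neighbours in `G`. -/
def create (G : SimpleGraph (Fin n)) : CNF RelVar :=
  {C | ∃ i j k : Fin n, i < j ∧ k ∈ (G.neighborSet i ∆ G.neighborSet j) \ {i, j} ∧
    C = {(pLit i j).neg, (oStar i k).neg, rStar i j k}}

/-- Red edges that are transferred from a vertex to its parent. -/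
def transfer (n : ℕ) : CNF RelVar :=
  {C | ∃ i j k : Fin n, i ≠ j ∧ i ≠ k ∧ j ≠ k ∧ i < j ∧
    C = {(pLit i j).neg, (oStar i k).neg, (aStar i k).neg, rStar i j k}}

/-- Red edges that are kept. -/
def keep (n : ℕ) : CNF RelVar :=
  {C | ∃ i j k m : Fin n,
    i ≠ j ∧ i ≠ k ∧ i ≠ m ∧ j ≠ k ∧ j ≠ m ∧ k ≠ m ∧ k < m ∧
    C = {(oStar i j).neg, (oStar j k).neg, (oStar j m).neg, (rStar i k m).neg, rStar j k m}}

/-- The inputs of the totalizer of `(vᵢ, vⱼ)`: the `n - 1` literals `r*ᵢⱼₖ` with `k ≠ j`, in the order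
of `k`. -/
def cardInput (i j q : ℕ) : Literal RelVar := rStar i j (if q < j then q else q + 1)

/-- For all distinct `vᵢ`, `vⱼ`: after the elimination of `vᵢ`, the red degree of `vⱼ` is at
most `d`. -/
def cardinality (n d : ℕ) : CNF RelVar :=
  {C | ∃ i j : Fin n, i ≠ j ∧ C ∈ Totalizer.atMost (cardInput i j) (RelVar.t i j) (n - 1) d}

end RelEncoding

open RelEncoding in
/-- The relative encoding `F(G, d)`. -/
def relEncoding {n : ℕ} (G : SimpleGraph (Fin n)) (d : ℕ) : CNF RelVar :=
  transitivity n ∪ atLeastOneParent n ∪ atMostOneParent n ∪ parentLater n ∪ auxiliary n ∪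
    create G ∪ transfer n ∪ keep n ∪ cardinality n d

/-! ## Random access machines

Structured programs over finitely many registers, a memory with indirect addressing, and a
write-only output. The arithmetic operations are addition and (truncated) subtraction only, so that
unit-cost time agrees with Turing machine time up to a polynomial. -/

namespace RAM

/-- Elementary instructions; `x`, `y`, `z` are names of registers. -/
inductive Instr
  /-- `x := c` -/
  | const (x c : ℕ)
  /-- `x := y + z` -/
  | add (x y z : ℕ)
  /-- `x := y - z`, or `0` if `y < z` -/
  | sub (x y z : ℕ)
  /-- `x := memory[y]` -/
  | load (x y : ℕ)
  /-- `memory[x] := y` -/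
  | store (x y : ℕ)
  /-- append the content of `x` to the output -/
  | print (x : ℕ)

/-- Programs. -/
inductive Prog
  | instr (c : Instr)
  | seq (P Q : Prog)
  /-- if `x ≠ 0` then `P` else `Q` -/
  | ite (x : ℕ) (P Q : Prog)
  /-- while `x ≠ 0` do `P` -/
  | loop (x : ℕ) (P : Prog)

/-- The registers, the memory, and the output so far. -/
structure State where
  reg : ℕ → ℕ
  mem : ℕ → ℕ
  out : List ℕ

/-- The effect of an elementary instruction. -/
def Instr.apply : Instr → State → State
  | .const x c, σ => { σ with reg := Function.update σ.reg x c }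
  | .add x y z, σ => { σ with reg := Function.update σ.reg x (σ.reg y + σ.reg z) }
  | .sub x y z, σ => { σ with reg := Function.update σ.reg x (σ.reg y - σ.reg z) }
  | .load x y, σ => { σ with reg := Function.update σ.reg x (σ.mem (σ.reg y)) }
  | .store x y, σ => { σ with mem := Function.update σ.mem (σ.reg x) (σ.reg y) }
  | .print x, σ => { σ with out := σ.out ++ [σ.reg x] }

/-- `Exec P σ k σ'`: started in state `σ`, the program `P` halts in state `σ'` after exactly `k` steps.
Every elementary instruction and every evaluation of a test is one step. -/
inductive Exec : Prog → State → ℕ → State → Prop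
  | instr (c : Instr) (σ : State) : Exec (.instr c) σ 1 (c.apply σ)
  | seq {P Q : Prog} {σ₁ σ₂ σ₃ : State} {k l : ℕ} :
      Exec P σ₁ k σ₂ → Exec Q σ₂ l σ₃ → Exec (.seq P Q) σ₁ (k + l) σ₃
  | iteTrue {x : ℕ} {P Q : Prog} {σ σ' : State} {k : ℕ} :
      σ.reg x ≠ 0 → Exec P σ k σ' → Exec (.ite x P Q) σ (k + 1) σ'
  | iteFalse {x : ℕ} {P Q : Prog} {σ σ' : State} {k : ℕ} :
      σ.reg x = 0 → Exec Q σ k σ' → Exec (.ite x P Q) σ (k + 1) σ'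
  | loopDone {x : ℕ} {P : Prog} {σ : State} :
      σ.reg x = 0 → Exec (.loop x P) σ 1 σ
  | loopStep {x : ℕ} {P : Prog} {σ₁ σ₂ σ₃ : State} {k l : ℕ} :
      σ₁.reg x ≠ 0 → Exec P σ₁ k σ₂ → Exec (.loop x P) σ₂ l σ₃ →
        Exec (.loop x P) σ₁ (k + l + 1) σ₃

/-- The initial state: the input is in the memory, everything else is zero or empty. -/
def initial (input : List ℕ) : State where
  reg := fun _ => 0
  mem := fun k => input.getD k 0
  out := []

/-- On the given input, `P` halts after `k` steps and has then written the given output. -/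
def Prog.Computes (P : Prog) (input : List ℕ) (k : ℕ) (output : List ℕ) : Prop :=
  ∃ σ : State, Exec P (initial input) k σ ∧ σ.out = output

end RAM

/-! ## Input and output of the construction -/

open Classical in
/-- The input `(G, d)` as a list of numbers: `n`, `d`, and the adjacency matrix of `G` row by row. -/
noncomputable def encodeInput {n : ℕ} (G : SimpleGraph (Fin n)) (d : ℕ) : List ℕ :=
  n :: d :: (List.finRange n).flatMap fun i =>
    (List.finRange n).map fun j => if G.Adj i j then 1 else 0

/-- A variable is written as its kind and its indices, padded to six numbers. -/
def encodeVar : RelVar → List ℕ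
  | .a i j => [0, i, j, 0, 0, 0]
  | .o i j => [1, i, j, 0, 0, 0]
  | .p i j => [2, i, j, 0, 0, 0]
  | .r i j k => [3, i, j, k, 0, 0]
  | .t i j lo len s => [4, i, j, lo, len, s]

/-- A literal is written as its sign (`1` if positive, `2` if negative) and its variable. -/
def encodeLiteral (l : Literal RelVar) : List ℕ := (if l.pos then 1 else 2) :: encodeVar l.var

/-- A clause is written as the sequence of its literals followed by `0`. -/
def encodeClause (c : List (Literal RelVar)) : List ℕ := c.flatMap encodeLiteral ++ [0]

/-- A formula is written as the sequence of its clauses. -/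
def encodeCNF (cs : List (List (Literal RelVar))) : List ℕ := cs.flatMap encodeClause

/-- `cs` lists the clauses of `F`, and the literals of each clause, in any order (repetitions are
allowed). -/
def IsListingOf (cs : List (List (Literal RelVar))) (F : CNF RelVar) : Prop :=
  {C : Clause RelVar | ∃ c ∈ cs, C = {l | l ∈ c}} = F

/-! Satisfiability. Name the vertex that results from a contraction after whichever of the two
contracted vertices has the larger index. Then at every stage of a contraction sequence the edges
that are not red are exactly those of `G` between surviving vertices, so a trigraph is determined by
its vertex set and its red graph `R`. Contracting `i` into `j` adds red edges at `j` only: to the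
red neighbours of `i`, and to the vertices on which `i` and `j` differ in `G` (`contractRed`,
`Represents`). A sequence thus amounts to an elimination order, a parent with larger index for each
eliminated vertex, and a red graph after each elimination. `IsScheme` states the conditions that the
clauses impose on such data, relative to a set `S` of surviving vertices, so that the first vertex
of the order can be removed or added in an induction.

The conditions on red edges are implications: `red` and `a` may contain more than the edges that are
really red. This is harmless, because degrees are only bounded from above. From a scheme one obtains
a sequence by contracting the first vertex into its parent and checking that the true red graph
stays inside `red` (`IsScheme.hasDSequence_aux`). Conversely, a sequence is read from its end, and
each contracted vertex is put in front of the order (`IsScheme.insert`,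
`Trigraph.HasDSequence.exists_scheme`). Schemes on all vertices correspond to satisfying assignments
once the totalizers are understood: the upward clauses force output `s` to be true when at least `s`
inputs are, and the outputs that count correctly satisfy every clause.

Construction. The program is assembled from combinators that carry their own time bounds.
`Evaluates` and `Emits` treat the registers below `b` and the memory as read-only and bound time by
a polynomial in a number `M` that bounds all protected contents. A computed value goes into register
`b`, which then becomes protected while `M` grows to a polynomial in `M`; composition of polynomials
gives the next bound. Since the nesting is fixed, the total is polynomial in the largest input
number. The totalizer tree needs no recursion: its nodes occur on the paths from the root to the
leaves, and these paths are followed by iteration (`Totalizer.nodeAt`); nodes that are met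
repeatedly only repeat clauses. -/

/-! ## Polynomial-time procedures on random access machines -/

namespace RAM

/-- Started in `σ`, the program halts after at most `t` steps in a state that satisfies `Q`. -/
def Runs (P : Prog) (t : ℕ) (σ : State) (Q : State → Prop) : Prop :=
  ∃ k ≤ t, ∃ σ', Exec P σ k σ' ∧ Q σ'

namespace Runs

lemma mono {P : Prog} {t t' : ℕ} {σ : State} {Q Q' : State → Prop} (h : Runs P t σ Q)
    (ht : t ≤ t') (hQ : ∀ σ', Q σ' → Q' σ') : Runs P t' σ Q' := by
  obtain ⟨k, hk, σ', he, hq⟩ := h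
  exact ⟨k, hk.trans ht, σ', he, hQ _ hq⟩

lemma instr (c : Instr) {σ : State} {Q : State → Prop} (h : Q (c.apply σ)) :
    Runs (.instr c) 1 σ Q := ⟨1, le_rfl, _, .instr c σ, h⟩

lemma seq {P P' : Prog} {t t' : ℕ} {σ : State} {Q Q' : State → Prop} (h : Runs P t σ Q)
    (h' : ∀ σ', Q σ' → Runs P' t' σ' Q') : Runs (.seq P P') (t + t') σ Q' := by
  obtain ⟨k, hk, σ', he, hq⟩ := h
  obtain ⟨l, hl, σ'', he', hq'⟩ := h' _ hq
  exact ⟨k + l, by omega, σ'', .seq he he', hq'⟩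

lemma ite {x : ℕ} {P P' : Prog} {t : ℕ} {σ : State} {Q : State → Prop}
    (h : σ.reg x ≠ 0 → Runs P t σ Q) (h' : σ.reg x = 0 → Runs P' t σ Q) :
    Runs (.ite x P P') (t + 1) σ Q := by
  by_cases hx : σ.reg x = 0
  · obtain ⟨k, hk, σ', he, hq⟩ := h' hx
    exact ⟨k + 1, by omega, σ', .iteFalse hx he, hq⟩
  · obtain ⟨k, hk, σ', he, hq⟩ := h hx
    exact ⟨k + 1, by omega, σ', .iteTrue hx he, hq⟩

/-- A loop whose body decreases its counter by one. -/
lemma countdown {x : ℕ} {P : Prog} {t : ℕ} (I : ℕ → State → Prop)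
    (hreg : ∀ v σ, I v σ → σ.reg x = v) (hbody : ∀ v σ, I (v + 1) σ → Runs P t σ (I v)) :
    ∀ N σ, I N σ → Runs (.loop x P) (N * (t + 1) + 1) σ (I 0) := by
  intro N
  induction N with
  | zero => exact fun σ h => ⟨1, by omega, σ, .loopDone (hreg _ _ h), h⟩
  | succ N ih =>
    intro σ h
    obtain ⟨k, hk, σ', he, hq⟩ := hbody _ _ h
    obtain ⟨l, hl, σ'', he', hq'⟩ := ih _ hq
    refine ⟨k + l + 1, ?_, σ'', .loopStep ?_ he he', hq'⟩
    · rw [Nat.succ_mul]; omega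
    · rw [hreg _ _ h]; omega

end Runs

/-- The registers below `b` and the memory are the same. -/
def Keeps (b : ℕ) (σ σ' : State) : Prop := (∀ r < b, σ'.reg r = σ.reg r) ∧ σ'.mem = σ.mem

/-- The registers below `b` and the memory contain numbers of size at most `M`. -/
def Small (b : ℕ) (σ : State) (M : ℕ) : Prop := (∀ r < b, σ.reg r ≤ M) ∧ ∀ a, σ.mem a ≤ M

lemma Keeps.refl (b : ℕ) (σ : State) : Keeps b σ σ := ⟨fun _ _ => rfl, rfl⟩

lemma Keeps.trans {b c : ℕ} {σ σ' σ'' : State} (h : Keeps b σ σ') (h' : Keeps c σ' σ'')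
    (hbc : b ≤ c) : Keeps b σ σ'' :=
  ⟨fun r hr => (h'.1 r (hr.trans_le hbc)).trans (h.1 r hr), h'.2.trans h.2⟩

/-- Used after a value has been computed into register `b`: that register joins the protected ones,
at the price of a larger bound. -/
lemma Small.succ {b : ℕ} {σ σ' : State} {M M' : ℕ} (h : Small b σ M) (hk : Keeps b σ σ')
    (hM : M ≤ M') (hb : σ'.reg b ≤ M') : Small (b + 1) σ' M' := by
  refine ⟨fun r hr => ?_, fun a => by rw [hk.2]; exact (h.2 a).trans hM⟩
  rcases Nat.lt_succ_iff_lt_or_eq.1 hr with hr | rfl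
  · rw [hk.1 r hr]; exact (h.1 r hr).trans hM
  · exact hb

lemma Small.keeps {b : ℕ} {σ σ' : State} {M : ℕ} (h : Small b σ M) (hk : Keeps b σ σ') :
    Small b σ' M :=
  ⟨fun r hr => by rw [hk.1 r hr]; exact h.1 r hr, fun a => by rw [hk.2]; exact h.2 a⟩

/-- `f` depends on the registers below `b` and the memory only. -/
def IsLocal {α : Type} (b : ℕ) (f : (ℕ → ℕ) → (ℕ → ℕ) → α) : Prop :=
  ∀ ρ ρ' μ, (∀ r < b, ρ' r = ρ r) → f ρ' μ = f ρ μ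

lemma IsLocal.keeps {α : Type} {b : ℕ} {f : (ℕ → ℕ) → (ℕ → ℕ) → α} (h : IsLocal b f)
    {σ σ' : State} (hk : Keeps b σ σ') : f σ'.reg σ'.mem = f σ.reg σ.mem := by
  rw [hk.2]; exact h _ _ _ hk.1

/-- The number `f`, a function of the registers below `b` and of the memory, is polynomially bounded
and can be computed in polynomial time into any register from `b` on, without changing the registers
before that one. -/
structure Evaluates (b : ℕ) (f : (ℕ → ℕ) → (ℕ → ℕ) → ℕ) : Prop where
  isLocal : IsLocal b f
  runs : ∀ c, b ≤ c → ∃ (P : Prog) (B : Polynomial ℕ), ∀ σ M, Small c σ M →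
    f σ.reg σ.mem ≤ B.eval M ∧ Runs P (B.eval M) σ fun σ' =>
      Keeps c σ σ' ∧ σ'.out = σ.out ∧ σ'.reg c = f σ.reg σ.mem

/-- The list `f`, a function of the registers below `b` and of the memory, can be printed in
polynomial time without changing these. -/
structure Emits (b : ℕ) (f : (ℕ → ℕ) → (ℕ → ℕ) → List ℕ) : Prop where
  isLocal : IsLocal b f
  runs : ∃ (P : Prog) (B : Polynomial ℕ), ∀ σ M, Small b σ M →
    Runs P (B.eval M) σ fun σ' => Keeps b σ σ' ∧ σ'.out = σ.out ++ f σ.reg σ.mem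

/-- Whether `p` holds can be decided in polynomial time. -/
def Decides (b : ℕ) (p : (ℕ → ℕ) → (ℕ → ℕ) → Prop) : Prop :=
  ∃ f, Evaluates b f ∧ ∀ ρ μ, p ρ μ ↔ f ρ μ ≠ 0

/-! ### Closure of computable numbers under arithmetic and case distinction. -/

namespace Evaluates

variable {b : ℕ} {f g : (ℕ → ℕ) → (ℕ → ℕ) → ℕ}

lemma mono {c : ℕ} (h : Evaluates b f) (hbc : b ≤ c) : Evaluates c f where
  isLocal := fun ρ ρ' μ hr => h.isLocal ρ ρ' μ fun r hrb => hr r (hrb.trans_le hbc)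
  runs := fun c' hc' => h.runs c' (hbc.trans hc')

lemma congr (h : Evaluates b f) (hfg : ∀ ρ μ, g ρ μ = f ρ μ) : Evaluates b g := by
  obtain rfl : g = f := funext fun ρ => funext fun μ => hfg ρ μ
  exact h

lemma keeps_update {c : ℕ} (σ : State) (v : ℕ) :
    Keeps c σ { σ with reg := Function.update σ.reg c v } :=
  ⟨fun r hr => Function.update_of_ne (by omega) _ _, rfl⟩

lemma const (v : ℕ) : Evaluates b fun _ _ => v where
  isLocal := fun _ _ _ _ => rfl
  runs := fun c _ => ⟨.instr (.const c v), Polynomial.C (v + 1), fun σ M _ => by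
    rw [Polynomial.eval_C]
    exact ⟨by omega, (Runs.instr _ ⟨keeps_update _ _, rfl, Function.update_self _ _ _⟩).mono
      (by omega) fun _ h => h⟩⟩

/-- Combining two values by a program that reads them from the registers `c` and `c + 1`. -/
lemma binary (hf : Evaluates b f) (hg : Evaluates b g) (op : ℕ → ℕ → ℕ) (I : ℕ → Instr)
    (hop : ∀ x y, op x y ≤ x + y)
    (hI : ∀ c σ, (I c).apply σ =
      { σ with reg := Function.update σ.reg c (op (σ.reg c) (σ.reg (c + 1))) }) :
    Evaluates b fun ρ μ => op (f ρ μ) (g ρ μ) where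
  isLocal := fun ρ ρ' μ hr => by
    show op _ _ = op _ _
    rw [hf.isLocal ρ ρ' μ hr, hg.isLocal ρ ρ' μ hr]
  runs := fun c hc => by
    obtain ⟨P, B, hP⟩ := hf.runs c hc
    obtain ⟨Q, D, hQ⟩ := hg.runs (c + 1) (by omega)
    -- The second program runs when register `c` already holds a value of size up to `B.eval M`;
    -- hence its bound is composed with `X + B`.
    refine ⟨.seq P (.seq Q (.instr (I c))), B + D.comp (Polynomial.X + B) + 1, fun σ M hσ => ?_⟩
    simp only [Polynomial.eval_add, Polynomial.eval_comp, Polynomial.eval_X, Polynomial.eval_one]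
    obtain ⟨hb, hr⟩ := hP σ M hσ
    have key : ∀ σ₁, (Keeps c σ σ₁ ∧ σ₁.out = σ.out ∧ σ₁.reg c = f σ.reg σ.mem) →
        Small (c + 1) σ₁ (M + B.eval M) := fun σ₁ h =>
      hσ.succ h.1 (by omega) (by rw [h.2.2]; omega)
    -- The bound `D` applies only to states in which register `c` is bounded too, so it is read off
    -- after the first program, where `g` still has its old value.
    have hgv : g σ.reg σ.mem ≤ D.eval (M + B.eval M) := by
      obtain ⟨_, _, σ₁, _, h1⟩ := hr
      rw [← (hg.isLocal).keeps (h1.1.trans (Keeps.refl c _) le_rfl |> fun h =>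
        (⟨fun r hr => h.1 r (hr.trans_le hc), h.2⟩ : Keeps b σ σ₁))]
      exact (hQ σ₁ _ (key _ h1)).1
    refine ⟨(hop _ _).trans (by omega), ?_⟩
    rw [add_assoc]
    refine hr.seq fun σ₁ h1 => ((hQ σ₁ _ (key _ h1)).2).seq fun σ₂ h2 => Runs.instr _ ?_
    have hk : Keeps b σ σ₁ := ⟨fun r hr => h1.1.1 r (hr.trans_le hc), h1.1.2⟩
    rw [hI]
    refine ⟨(h1.1.trans h2.1 (Nat.le_succ c)).trans (keeps_update _ _) le_rfl, ?_, ?_⟩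
    · exact h2.2.1.trans h1.2.1
    · simp only [Function.update_self]
      rw [h2.2.2, h2.1.1 c (Nat.lt_succ_self c), h1.2.2, (hg.isLocal).keeps hk]

lemma add (hf : Evaluates b f) (hg : Evaluates b g) : Evaluates b fun ρ μ => f ρ μ + g ρ μ :=
  binary hf hg (· + ·) (fun c => .add c c (c + 1)) (fun _ _ => le_rfl) fun _ _ => rfl

lemma sub (hf : Evaluates b f) (hg : Evaluates b g) : Evaluates b fun ρ μ => f ρ μ - g ρ μ :=
  binary hf hg (· - ·) (fun c => .sub c c (c + 1)) (fun _ _ => by omega) fun _ _ => rfl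

lemma reg {r : ℕ} (hr : r < b) : Evaluates b fun ρ _ => ρ r where
  isLocal := fun _ _ _ h => h r hr
  runs := fun c hc => by
    refine ⟨.seq (.instr (.const c 0)) (.instr (.add c c r)), Polynomial.X + 2, fun σ M hσ => ?_⟩
    have h2 : (Polynomial.X + 2 : Polynomial ℕ).eval M = M + 2 := by simp
    rw [h2]
    have := hσ.1 r (by omega)
    refine ⟨by omega, ((Runs.instr (Q := fun σ₁ => σ₁ = (Instr.const c 0).apply σ) _ rfl).seq
      (t' := 1) fun σ₁ h1 => Runs.instr _ ?_).mono (by omega) fun _ h => h⟩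
    subst h1
    refine ⟨(keeps_update _ _).trans (keeps_update _ _) le_rfl, rfl, ?_⟩
    simp [Instr.apply, Function.update_of_ne (show r ≠ c by omega)]

lemma load (hf : Evaluates b f) : Evaluates b fun ρ μ => μ (f ρ μ) where
  isLocal := fun ρ ρ' μ hr => by
    show μ _ = μ _
    rw [hf.isLocal ρ ρ' μ hr]
  runs := fun c hc => by
    obtain ⟨P, B, hP⟩ := hf.runs c hc
    refine ⟨.seq P (.instr (.load c c)), B + 1 + Polynomial.X, fun σ M hσ => ?_⟩
    simp only [Polynomial.eval_add, Polynomial.eval_X, Polynomial.eval_one]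
    refine ⟨(hσ.2 _).trans (by omega), (((hP σ M hσ).2).seq (t' := 1) fun σ₁ h1 =>
      Runs.instr _ ?_).mono (by omega) fun _ h => h⟩
    refine ⟨h1.1.trans (keeps_update _ _) le_rfl, h1.2.1, ?_⟩
    simp [Instr.apply, h1.2.2, h1.1.2]

lemma ite_ne_zero {h : (ℕ → ℕ) → (ℕ → ℕ) → ℕ} (hh : Evaluates b h) (hf : Evaluates b f)
    (hg : Evaluates b g) :
    Evaluates b fun ρ μ => if h ρ μ ≠ 0 then f ρ μ else g ρ μ where
  isLocal := fun ρ ρ' μ hr => by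
    show (if _ then _ else _) = (if _ then _ else _)
    rw [hf.isLocal ρ ρ' μ hr, hg.isLocal ρ ρ' μ hr, hh.isLocal ρ ρ' μ hr]
  runs := fun c hc => by
    obtain ⟨P, B, hP⟩ := hh.runs c hc
    obtain ⟨P₁, B₁, hP₁⟩ := hf.runs c hc
    obtain ⟨P₂, B₂, hP₂⟩ := hg.runs c hc
    refine ⟨.seq P (.ite c P₁ P₂), B + (B₁ + B₂ + 1), fun σ M hσ => ?_⟩
    simp only [Polynomial.eval_add, Polynomial.eval_one]
    have b1 := (hP₁ σ M hσ).1
    have b2 := (hP₂ σ M hσ).1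
    refine ⟨by split_ifs <;> omega, ((hP σ M hσ).2).seq fun σ₁ h1 => ?_⟩
    have hk : Keeps b σ σ₁ := ⟨fun r hr => h1.1.1 r (hr.trans_le hc), h1.1.2⟩
    refine Runs.ite (fun h0 => ?_) (fun h0 => ?_)
    · refine ((hP₁ σ₁ M (hσ.keeps h1.1)).2).mono (by omega) fun σ₂ h2 =>
        ⟨h1.1.trans h2.1 le_rfl, h2.2.1.trans h1.2.1, ?_⟩
      rw [h2.2.2, hf.isLocal.keeps hk, if_pos (by rwa [h1.2.2] at h0)]
    · refine ((hP₂ σ₁ M (hσ.keeps h1.1)).2).mono (by omega) fun σ₂ h2 =>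
        ⟨h1.1.trans h2.1 le_rfl, h2.2.1.trans h1.2.1, ?_⟩
      rw [h2.2.2, hg.isLocal.keeps hk, if_neg (by rw [h1.2.2] at h0; simpa using h0)]

lemma ite {p : (ℕ → ℕ) → (ℕ → ℕ) → Prop} [∀ ρ μ, Decidable (p ρ μ)] (hp : Decides b p)
    (hf : Evaluates b f) (hg : Evaluates b g) :
    Evaluates b fun ρ μ => if p ρ μ then f ρ μ else g ρ μ := by
  obtain ⟨h, hh, hiff⟩ := hp
  refine (ite_ne_zero hh hf hg).congr fun ρ μ => ?_
  simp only [hiff ρ μ]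

end Evaluates

namespace Decides

variable {b : ℕ} {f g : (ℕ → ℕ) → (ℕ → ℕ) → ℕ} {p q : (ℕ → ℕ) → (ℕ → ℕ) → Prop}

/-- Truncated subtraction turns comparisons into tests for zero; in the same way, the sum of the two
differences tests equality below. -/
lemma lt (hf : Evaluates b f) (hg : Evaluates b g) : Decides b fun ρ μ => f ρ μ < g ρ μ :=
  ⟨_, hg.sub hf, fun _ _ => by omega⟩

lemma le (hf : Evaluates b f) (hg : Evaluates b g) : Decides b fun ρ μ => f ρ μ ≤ g ρ μ :=
  ⟨_, (hg.add (.const 1)).sub hf, fun _ _ => by omega⟩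

lemma ne (hf : Evaluates b f) (hg : Evaluates b g) : Decides b fun ρ μ => f ρ μ ≠ g ρ μ :=
  ⟨_, (hg.sub hf).add (hf.sub hg), fun _ _ => by omega⟩

lemma eq (hf : Evaluates b f) (hg : Evaluates b g) : Decides b fun ρ μ => f ρ μ = g ρ μ :=
  ⟨_, (Evaluates.const 1).sub ((hg.sub hf).add (hf.sub hg)), fun _ _ => by omega⟩

lemma and (hp : Decides b p) (hq : Decides b q) : Decides b fun ρ μ => p ρ μ ∧ q ρ μ := by
  obtain ⟨f, hf, hf'⟩ := hp
  obtain ⟨g, hg, hg'⟩ := hq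
  refine ⟨_, Evaluates.ite_ne_zero hf hg (.const 0), fun ρ μ => ?_⟩
  show p ρ μ ∧ q ρ μ ↔ _
  rw [hf', hg']
  by_cases h : f ρ μ = 0 <;> simp [h]

end Decides

end RAM

/-! ### Bounded iteration and printing. -/

namespace RAM

/-- The program `x := y`. -/
def copy (x y : ℕ) : Prog := .seq (.instr (.const x 0)) (.instr (.add x x y))

lemma Runs.copy {x y : ℕ} (hxy : x ≠ y) {σ : State} {Q : State → Prop}
    (h : Q { σ with reg := Function.update σ.reg x (σ.reg y) }) : Runs (copy x y) 2 σ Q := by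
  refine (Runs.instr (Q := fun σ₁ => σ₁ = (Instr.const x 0).apply σ) _ rfl).seq (t' := 1)
    fun σ₁ h1 => Runs.instr _ ?_
  subst h1
  convert h using 1
  simp [Instr.apply, Function.update_of_ne hxy.symm]

/-- The program that decreases the register `x` by one. -/
def decrease (x : ℕ) : Prog := .seq (.instr (.const (x + 1) 1)) (.instr (.sub x x (x + 1)))

lemma Runs.decrease {x : ℕ} {σ : State} {Q : State → Prop}
    (h : ∀ σ', Keeps x σ σ' → σ'.reg x = σ.reg x - 1 → σ'.out = σ.out → Q σ') :
    Runs (decrease x) 2 σ Q := by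
  refine (Runs.instr (Q := fun σ₁ => σ₁ = (Instr.const (x + 1) 1).apply σ) _ rfl).seq (t' := 1)
    fun σ₁ h1 => Runs.instr _ ?_
  subst h1
  refine h _ ⟨fun r hr => ?_, rfl⟩ ?_ rfl
  · simp [Instr.apply, Function.update_of_ne (show r ≠ x by omega),
      Function.update_of_ne (show r ≠ x + 1 by omega)]
  · simp [Instr.apply]

namespace Evaluates

variable {b : ℕ} {f g : (ℕ → ℕ) → (ℕ → ℕ) → ℕ}

lemma runs_keeps (hf : Evaluates b f) {c : ℕ} (hc : b ≤ c) :
    ∃ (P : Prog) (B : Polynomial ℕ), ∀ σ σ' M, Small c σ' M → Keeps b σ σ' →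
      f σ.reg σ.mem ≤ B.eval M ∧ Runs P (B.eval M) σ' fun σ'' =>
        Keeps c σ' σ'' ∧ σ''.out = σ'.out ∧ σ''.reg c = f σ.reg σ.mem := by
  obtain ⟨P, B, hP⟩ := hf.runs c hc
  refine ⟨P, B, fun σ σ' M hs hk => ?_⟩
  rw [← hf.isLocal.keeps hk]
  exact hP σ' M hs

/-- Iteration with two state variables `x`, `y`. -/
lemma iterate {X Y N U V : (ℕ → ℕ) → (ℕ → ℕ) → ℕ} {s₁ s₂ : ℕ → (ℕ → ℕ) → (ℕ → ℕ) → ℕ}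
    (x y : (ℕ → ℕ) → (ℕ → ℕ) → ℕ → ℕ)
    (hX : Evaluates b X) (hY : Evaluates b Y) (hN : Evaluates b N)
    (hU : Evaluates b U) (hV : Evaluates b V)
    (h₁ : ∀ c, b ≤ c → Evaluates (c + 3) (s₁ c)) (h₂ : ∀ c, b ≤ c → Evaluates (c + 3) (s₂ c))
    (hx0 : ∀ ρ μ, x ρ μ 0 = X ρ μ) (hy0 : ∀ ρ μ, y ρ μ 0 = Y ρ μ)
    (hx : ∀ c ρ ρ' μ t, b ≤ c → (∀ r < b, ρ' r = ρ r) → ρ' c = x ρ μ t → ρ' (c + 1) = y ρ μ t →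
      s₁ c ρ' μ = x ρ μ (t + 1))
    (hy : ∀ c ρ ρ' μ t, b ≤ c → (∀ r < b, ρ' r = ρ r) → ρ' c = x ρ μ t → ρ' (c + 1) = y ρ μ t →
      s₂ c ρ' μ = y ρ μ (t + 1))
    (hxU : ∀ ρ μ t, t ≤ N ρ μ → x ρ μ t ≤ U ρ μ * V ρ μ)
    (hyU : ∀ ρ μ t, t ≤ N ρ μ → y ρ μ t ≤ U ρ μ * V ρ μ)
    (hloc : IsLocal b fun ρ μ => x ρ μ (N ρ μ)) :
    Evaluates b fun ρ μ => x ρ μ (N ρ μ) where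
  isLocal := hloc
  runs := fun c hc => by
    obtain ⟨P₁, B₁, H₁⟩ := hX.runs_keeps hc
    obtain ⟨P₂, B₂, H₂⟩ := hY.runs_keeps (c := c + 1) (by omega)
    obtain ⟨P₃, B₃, H₃⟩ := hN.runs_keeps (c := c + 2) (by omega)
    obtain ⟨_, BU, HU⟩ := hU.runs_keeps hc
    obtain ⟨_, BV, HV⟩ := hV.runs_keeps hc
    obtain ⟨P₄, B₄, H₄⟩ := (h₁ c hc).runs (c + 3) le_rfl
    obtain ⟨P₅, B₅, H₅⟩ := ((h₂ c hc).mono (Nat.le_succ _)).runs (c + 4) le_rfl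
    set W : Polynomial ℕ := Polynomial.X + BU * BV with hW
    set W₁ : Polynomial ℕ := W + B₁ with hW₁
    set W₂ : Polynomial ℕ := W₁ + B₂.comp W₁ with hW₂
    set W₃ : Polynomial ℕ := W₂ + B₃.comp W₂ with hW₃
    set W₄ : Polynomial ℕ := W₃ + B₄.comp W₃ with hW₄
    refine ⟨.seq P₁ (.seq P₂ (.seq P₃ (.loop (c + 2) (.seq (decrease (c + 2)) (.seq P₄ (.seq P₅
        (.seq (copy c (c + 3)) (copy (c + 1) (c + 4))))))))),
      W + (B₁ + (B₂.comp W₁ + (B₃.comp W₂ + (B₃.comp W₂ * (2 + (B₄.comp W₃ + (B₅.comp W₄ + (2 + 2)))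
        + 1) + 1)))), fun σ M hσ => ?_⟩
    have hWe : W.eval M = M + BU.eval M * BV.eval M := by simp [hW]
    have hW1 : W₁.eval M = W.eval M + B₁.eval M := by simp [hW₁]
    have hW2 : W₂.eval M = W₁.eval M + B₂.eval (W₁.eval M) := by simp [hW₂]
    have hW3 : W₃.eval M = W₂.eval M + B₃.eval (W₂.eval M) := by simp [hW₃]
    have hW4 : W₄.eval M = W₃.eval M + B₄.eval (W₃.eval M) := by simp [hW₄]
    have h2e : (2 : Polynomial ℕ).eval M = 2 := by simp
    simp only [Polynomial.eval_add, Polynomial.eval_comp, Polynomial.eval_mul, Polynomial.eval_one,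
      h2e]
    clear_value W W₁ W₂ W₃ W₄
    have hUV : U σ.reg σ.mem * V σ.reg σ.mem ≤ BU.eval M * BV.eval M :=
      Nat.mul_le_mul (HU σ σ M hσ (Keeps.refl _ _)).1 (HV σ σ M hσ (Keeps.refl _ _)).1
    have hxW : ∀ t ≤ N σ.reg σ.mem, x σ.reg σ.mem t ≤ W.eval M := fun t ht =>
      (hxU _ _ t ht).trans (hUV.trans (by omega))
    have hyW : ∀ t ≤ N σ.reg σ.mem, y σ.reg σ.mem t ≤ W.eval M := fun t ht =>
      (hyU _ _ t ht).trans (hUV.trans (by omega))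
    -- The summand `W` of the polynomial pays for the size of the result; the remaining summands pay
    -- for the time.
    refine ⟨(hxW _ le_rfl).trans (by omega), Runs.mono (?_ : Runs _ _ _ _)
      (Nat.le_add_left _ (W.eval M)) fun _ h => h⟩
    refine ((H₁ σ σ M hσ (Keeps.refl _ _)).2).seq fun σ₁ h1 => ?_
    have k1 : Keeps c σ σ₁ := h1.1
    have s1 : Small (c + 1) σ₁ (W₁.eval M) := hσ.succ k1 (by omega) (by
      rw [h1.2.2]; exact ((H₁ σ σ M hσ (Keeps.refl _ _)).1).trans (by omega))
    have k1b : Keeps b σ σ₁ := ⟨fun r hr => k1.1 r (by omega), k1.2⟩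
    refine ((H₂ σ σ₁ _ s1 k1b).2).seq fun σ₂ h2 => ?_
    have k2 : Keeps c σ σ₂ := k1.trans h2.1 (by omega)
    have s2 : Small (c + 2) σ₂ (W₂.eval M) := s1.succ h2.1 (by omega) (by
      rw [h2.2.2]; exact ((H₂ σ σ₁ _ s1 k1b).1).trans (by omega))
    have k2b : Keeps b σ σ₂ := ⟨fun r hr => k2.1 r (by omega), k2.2⟩
    refine ((H₃ σ σ₂ _ s2 k2b).2).seq fun σ₃ h3 => ?_
    have k3 : Keeps c σ σ₃ := k2.trans h3.1 (by omega)
    have hNB : N σ.reg σ.mem ≤ B₃.eval (W₂.eval M) := (H₃ σ σ₂ _ s2 k2b).1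
    refine (Runs.countdown (t := 2 + (B₄.eval (W₃.eval M) + (B₅.eval (W₄.eval M) + (2 + 2))))
      (fun v σ' => v ≤ N σ.reg σ.mem ∧ Keeps c σ σ' ∧ σ'.out = σ.out ∧ σ'.reg (c + 2) = v ∧
        σ'.reg c = x σ.reg σ.mem (N σ.reg σ.mem - v) ∧
        σ'.reg (c + 1) = y σ.reg σ.mem (N σ.reg σ.mem - v))
      (fun v σ' h => h.2.2.2.1) ?_ (N σ.reg σ.mem) σ₃ ?_).mono ?_ ?_
    · rintro v σ' ⟨hv, hk, ho, hr, hxv, hyv⟩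
      refine (Runs.decrease (Q := fun σ'' => Keeps (c + 2) σ' σ'' ∧ σ''.reg (c + 2) = v ∧
        σ''.out = σ.out) fun σ'' q1 q2 q3 => ⟨q1, by omega, q3.trans ho⟩).seq
          fun σ₄ ⟨k4, r4, o4⟩ => ?_
      have k4c : Keeps c σ σ₄ := hk.trans k4 (by omega)
      have hx4 : σ₄.reg c = x σ.reg σ.mem (N σ.reg σ.mem - (v + 1)) := by rw [k4.1 c (by omega), hxv]
      have hy4 : σ₄.reg (c + 1) = y σ.reg σ.mem (N σ.reg σ.mem - (v + 1)) := by
        rw [k4.1 (c + 1) (by omega), hyv]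
      have s4 : Small (c + 3) σ₄ (W₃.eval M) := by
        refine Small.succ (Small.succ (Small.succ hσ k4c (by omega : M ≤ W₃.eval M) ?_)
          (Keeps.refl _ _) le_rfl ?_) (Keeps.refl _ _) le_rfl ?_
        · rw [hx4]; exact (hxW _ (by omega)).trans (by omega)
        · rw [hy4]; exact (hyW _ (by omega)).trans (by omega)
        · omega
      have hstep : N σ.reg σ.mem - (v + 1) + 1 = N σ.reg σ.mem - v := by omega
      have e4 : s₁ c σ₄.reg σ₄.mem = x σ.reg σ.mem (N σ.reg σ.mem - v) := by
        rw [← hstep, k4c.2]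
        exact hx c _ _ _ _ hc (fun r hr => k4c.1 r (by omega)) hx4 hy4
      have e5 : s₂ c σ₄.reg σ₄.mem = y σ.reg σ.mem (N σ.reg σ.mem - v) := by
        rw [← hstep, k4c.2]
        exact hy c _ _ _ _ hc (fun r hr => k4c.1 r (by omega)) hx4 hy4
      refine ((H₄ σ₄ _ s4).2).seq fun σ₅ ⟨k5, o5, r5⟩ => ?_
      have s5 : Small (c + 4) σ₅ (W₄.eval M) := s4.succ k5 (by omega) (by
        rw [r5]; exact ((H₄ σ₄ _ s4).1).trans (by omega))
      refine ((H₅ σ₅ _ s5).2).seq fun σ₆ ⟨k6, o6, r6⟩ => ?_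
      refine (Runs.copy (by omega) (Q := fun σ₇ => σ₇ = { σ₆ with
        reg := Function.update σ₆.reg c (σ₆.reg (c + 3)) }) rfl).seq fun σ₇ h7 => ?_
      subst h7
      refine Runs.copy (by omega) ⟨by omega, ⟨fun r hr => ?_, ?_⟩, ?_, ?_, ?_, ?_⟩
      · simp only [Function.update_of_ne (show r ≠ c + 1 by omega),
          Function.update_of_ne (show r ≠ c by omega)]
        rw [k6.1 r (by omega), k5.1 r (by omega), k4c.1 r hr]
      · exact k6.2.trans (k5.2.trans k4c.2)
      · exact o6.trans (o5.trans o4)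
      · simp only [Function.update_of_ne (show c + 2 ≠ c + 1 by omega),
          Function.update_of_ne (show c + 2 ≠ c by omega)]
        rw [k6.1 _ (by omega), k5.1 _ (by omega), r4]
      · simp only [Function.update_of_ne (show c ≠ c + 1 by omega), Function.update_self]
        rw [k6.1 _ (by omega), r5, e4]
      · simp only [Function.update_self, Function.update_of_ne (show c + 4 ≠ c by omega)]
        rw [r6, ← e5]
        exact (h₂ c hc).isLocal.keeps k5
    · refine ⟨le_rfl, k3, h3.2.1.trans (h2.2.1.trans h1.2.1), h3.2.2, ?_, ?_⟩
      · rw [Nat.sub_self, hx0, h3.1.1 c (by omega), h2.1.1 c (by omega), h1.2.2]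
      · rw [Nat.sub_self, hy0, h3.1.1 (c + 1) (by omega), h2.2.2]
    · exact Nat.add_le_add_right (Nat.mul_le_mul_right _ hNB) 1
    · rintro σ' ⟨_, hk, ho, _, hxv, _⟩
      exact ⟨hk, ho, hxv⟩

lemma mul (hf : Evaluates b f) (hg : Evaluates b g) : Evaluates b fun ρ μ => f ρ μ * g ρ μ := by
  refine iterate (s₁ := fun c ρ μ => ρ c + g ρ μ) (s₂ := fun _ _ _ => 0)
    (fun ρ μ t => t * g ρ μ) (fun _ _ _ => 0) (.const 0) (.const 0) hf hf hg
    (fun c hc => (reg (by omega)).add (hg.mono (by omega))) (fun c hc => .const 0)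
    (fun _ _ => Nat.zero_mul _) (fun _ _ => rfl) ?_ (fun _ _ _ _ _ _ _ _ _ => rfl)
    (fun ρ μ t ht => Nat.mul_le_mul_right _ ht) (fun _ _ _ _ => Nat.zero_le _) ?_
  · intro c ρ ρ' μ t _ hr hx _
    simp only [hx, hg.isLocal _ _ _ hr, Nat.succ_mul]
  · intro ρ ρ' μ hr
    simp only [hg.isLocal _ _ _ hr, hf.isLocal _ _ _ hr]

/-- Counting up to `f` with the pair `(t / 2, t % 2)`: the quotient grows by the current parity, and
the parity flips. -/
lemma half (hf : Evaluates b f) : Evaluates b fun ρ μ => f ρ μ / 2 := by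
  refine iterate (s₁ := fun c ρ _ => ρ c + ρ (c + 1)) (s₂ := fun c ρ _ => 1 - ρ (c + 1))
    (fun ρ μ t => t / 2) (fun _ _ t => t % 2) (.const 0) (.const 0) hf (hf.add (.const 1)) (.const 1)
    (fun c hc => (reg (by omega)).add (reg (by omega)))
    (fun c hc => (const 1).sub (reg (by omega)))
    (fun _ _ => rfl) (fun _ _ => rfl) ?_ ?_ ?_ ?_ ?_
  · intro c ρ ρ' μ t _ hr hx hy; simp only [hx, hy]; omega
  · intro c ρ ρ' μ t _ hr hx hy; simp only [hy]; omega
  · intro ρ μ t ht; omega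
  · intro ρ μ t ht; omega
  · intro ρ ρ' μ hr
    simp only [hf.isLocal _ _ _ hr]

end Evaluates

/-! ### Closure of printable lists under concatenation, case distinction and loops. -/

namespace Emits

variable {b : ℕ} {f g : (ℕ → ℕ) → (ℕ → ℕ) → List ℕ}

lemma congr (h : Emits b f) (hfg : ∀ ρ μ, g ρ μ = f ρ μ) : Emits b g := by
  obtain rfl : g = f := funext fun ρ => funext fun μ => hfg ρ μ
  exact h

/-- There is no empty program; overwriting the unprotected register `b` takes its place. -/
lemma nil : Emits b fun _ _ => [] where
  isLocal := fun _ _ _ _ => rfl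
  runs := ⟨.instr (.const b 0), 1, fun σ M _ => by
    rw [Polynomial.eval_one]
    exact Runs.instr _ ⟨Evaluates.keeps_update _ _, (List.append_nil _).symm⟩⟩

lemma singleton {v : (ℕ → ℕ) → (ℕ → ℕ) → ℕ} (hv : Evaluates b v) :
    Emits b fun ρ μ => [v ρ μ] where
  isLocal := fun ρ ρ' μ hr => by
    show [_] = [_]
    rw [hv.isLocal ρ ρ' μ hr]
  runs := by
    obtain ⟨P, B, hP⟩ := hv.runs b le_rfl
    refine ⟨.seq P (.instr (.print b)), B + 1, fun σ M hσ => ?_⟩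
    rw [Polynomial.eval_add, Polynomial.eval_one]
    refine ((hP σ M hσ).2).seq fun σ₁ h1 => Runs.instr _ ⟨h1.1, ?_⟩
    show σ₁.out ++ [σ₁.reg b] = _
    rw [h1.2.1, h1.2.2]

lemma append (hf : Emits b f) (hg : Emits b g) : Emits b fun ρ μ => f ρ μ ++ g ρ μ where
  isLocal := fun ρ ρ' μ hr => by
    show _ ++ _ = _ ++ _
    rw [hf.isLocal ρ ρ' μ hr, hg.isLocal ρ ρ' μ hr]
  runs := by
    obtain ⟨P, B, hP⟩ := hf.runs
    obtain ⟨P', B', hP'⟩ := hg.runs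
    refine ⟨.seq P P', B + B', fun σ M hσ => ?_⟩
    rw [Polynomial.eval_add]
    refine (hP σ M hσ).seq fun σ₁ h1 => (hP' σ₁ M (hσ.keeps h1.1)).mono le_rfl fun σ₂ h2 =>
      ⟨h1.1.trans h2.1 le_rfl, ?_⟩
    rw [h2.2, h1.2, hg.isLocal.keeps h1.1, List.append_assoc]

lemma cons {v : (ℕ → ℕ) → (ℕ → ℕ) → ℕ} (hv : Evaluates b v) (hf : Emits b f) :
    Emits b fun ρ μ => v ρ μ :: f ρ μ :=
  (singleton hv).append hf

lemma ite {p : (ℕ → ℕ) → (ℕ → ℕ) → Prop} [∀ ρ μ, Decidable (p ρ μ)] (hp : Decides b p)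
    (hf : Emits b f) (hg : Emits b g) : Emits b fun ρ μ => if p ρ μ then f ρ μ else g ρ μ := by
  obtain ⟨h, hh, hiff⟩ := hp
  suffices H : Emits b fun ρ μ => if h ρ μ ≠ 0 then f ρ μ else g ρ μ from
    H.congr fun ρ μ => by simp only [hiff ρ μ]
  refine ⟨fun ρ ρ' μ hr => ?_, ?_⟩
  · show (if _ then _ else _) = (if _ then _ else _)
    rw [hf.isLocal ρ ρ' μ hr, hg.isLocal ρ ρ' μ hr, hh.isLocal ρ ρ' μ hr]
  · obtain ⟨P, B, hP⟩ := hh.runs b le_rfl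
    obtain ⟨P₁, B₁, hP₁⟩ := hf.runs
    obtain ⟨P₂, B₂, hP₂⟩ := hg.runs
    refine ⟨.seq P (.ite b P₁ P₂), B + (B₁ + B₂ + 1), fun σ M hσ => ?_⟩
    simp only [Polynomial.eval_add, Polynomial.eval_one]
    refine ((hP σ M hσ).2).seq fun σ₁ h1 => Runs.ite (fun h0 => ?_) (fun h0 => ?_)
    · refine (hP₁ σ₁ M (hσ.keeps h1.1)).mono (by omega) fun σ₂ h2 =>
        ⟨h1.1.trans h2.1 le_rfl, ?_⟩
      rw [h2.2, h1.2.1, hf.isLocal.keeps h1.1, if_pos (by rwa [h1.2.2] at h0)]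
    · refine (hP₂ σ₁ M (hσ.keeps h1.1)).mono (by omega) fun σ₂ h2 =>
        ⟨h1.1.trans h2.1 le_rfl, ?_⟩
      rw [h2.2, h1.2.1, hg.isLocal.keeps h1.1, if_neg (by rw [h1.2.2] at h0; simpa using h0)]

/-- A loop over `v = N - 1, …, 0`; the register `b` contains `v`. -/
lemma flatMap {N : (ℕ → ℕ) → (ℕ → ℕ) → ℕ} {F : (ℕ → ℕ) → (ℕ → ℕ) → ℕ → List ℕ}
    (hN : Evaluates b N) (hF : Emits (b + 1) fun ρ μ => F ρ μ (ρ b))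
    (hloc : ∀ v, IsLocal b fun ρ μ => F ρ μ v) :
    Emits b fun ρ μ => (List.range (N ρ μ)).reverse.flatMap (F ρ μ) where
  isLocal := fun ρ ρ' μ hr => by
    show List.flatMap _ _ = List.flatMap _ _
    have hF' : F ρ' μ = F ρ μ := funext fun v => hloc v ρ ρ' μ hr
    rw [hN.isLocal ρ ρ' μ hr, hF']
  runs := by
    obtain ⟨P, B, hP⟩ := hN.runs b le_rfl
    obtain ⟨P', B', hP'⟩ := hF.runs
    refine ⟨.seq P (.loop b (.seq (decrease b) P')),
      B + (B * (2 + B'.comp (Polynomial.X + B) + 1) + 1), fun σ M hσ => ?_⟩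
    have h2e : (2 : Polynomial ℕ).eval M = 2 := by simp
    simp only [Polynomial.eval_add, Polynomial.eval_comp, Polynomial.eval_mul, Polynomial.eval_one,
      Polynomial.eval_X, h2e]
    have hNB := (hP σ M hσ).1
    refine ((hP σ M hσ).2).seq fun σ₁ h1 => ?_
    -- Invariant: the output so far, followed by what the remaining rounds will print, is the final
    -- output. The counter is decreased before the body runs, so the body sees the values from `N -
    -- 1` down to `0`.
    refine (Runs.countdown (t := 2 + B'.eval (M + B.eval M))
      (fun v σ' => v ≤ N σ.reg σ.mem ∧ Keeps b σ σ' ∧ σ'.reg b = v ∧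
        σ'.out ++ (List.range v).reverse.flatMap (F σ.reg σ.mem) =
          σ.out ++ (List.range (N σ.reg σ.mem)).reverse.flatMap (F σ.reg σ.mem))
      (fun v σ' h => h.2.2.1) ?_ (N σ.reg σ.mem) σ₁ ?_).mono ?_ ?_
    · rintro v σ' ⟨hv, hk, hr, ho⟩
      refine (Runs.decrease (Q := fun σ'' => Keeps b σ' σ'' ∧ σ''.reg b = v ∧
        σ''.out = σ'.out) fun σ'' q1 q2 q3 => ⟨q1, by omega, q3⟩).seq fun σ₂ ⟨k2, r2, o2⟩ => ?_
      have k2' : Keeps b σ σ₂ := hk.trans k2 le_rfl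
      refine (hP' σ₂ _ (hσ.succ k2' (Nat.le_add_right _ _) (by omega))).mono le_rfl
        fun σ₃ ⟨k3, o3⟩ => ⟨by omega, ?_, ?_, ?_⟩
      · exact k2'.trans k3 (Nat.le_succ b)
      · rw [k3.1 b (Nat.lt_succ_self b), r2]
      · rw [← ho, o3, o2, r2, List.range_succ, List.reverse_append, List.reverse_singleton,
          List.singleton_append, List.flatMap_cons, List.append_assoc, (hloc v).keeps k2']
    · exact ⟨le_rfl, h1.1, h1.2.2, by rw [h1.2.1]⟩
    · exact Nat.add_le_add_right (Nat.mul_le_mul_right _ hNB) 1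
    · rintro σ' ⟨_, hk, _, ho⟩
      exact ⟨hk, by simpa using ho⟩

end Emits

end RAM

/-! ## Listing the clauses -/

/-- The concatenation of `f (n - 1)`, …, `f 0`. -/
def forBelow {α : Type} (n : ℕ) (f : ℕ → List α) : List α := (List.range n).reverse.flatMap f

lemma mem_forBelow {α : Type} {n : ℕ} {f : ℕ → List α} {x : α} :
    x ∈ forBelow n f ↔ ∃ i < n, x ∈ f i := by
  simp [forBelow]

/-- The formula that is given by a list of clauses. -/
def clausesOf {X : Type} (cs : List (List (Literal X))) : CNF X :=
  {C | ∃ c ∈ cs, C = {l | l ∈ c}}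

section clausesOf

variable {X : Type} {C : Clause X}

lemma clausesOf_append (cs cs' : List (List (Literal X))) :
    clausesOf (cs ++ cs') = clausesOf cs ∪ clausesOf cs' := by
  ext C
  simp [clausesOf, or_and_right, exists_or]

lemma mem_clausesOf_forBelow {n : ℕ} {f : ℕ → List (List (Literal X))} :
    C ∈ clausesOf (forBelow n f) ↔ ∃ i < n, C ∈ clausesOf (f i) := by
  simp only [clausesOf, Set.mem_ofPred_eq, mem_forBelow]
  exact ⟨fun ⟨c, ⟨i, hi, hc⟩, h⟩ => ⟨i, hi, c, hc, h⟩, fun ⟨i, hi, c, hc, h⟩ => ⟨c, ⟨i, hi, hc⟩, h⟩⟩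

lemma mem_clausesOf_ite {p : Prop} [Decidable p] {c : List (Literal X)} :
    C ∈ clausesOf (if p then [c] else []) ↔ p ∧ C = {l | l ∈ c} := by
  by_cases h : p <;> simp [clausesOf, h]

end clausesOf

/-! ### Enumerating the totalizer tree by its root-to-leaf paths. -/

namespace Totalizer

/-- The child of a node that contains the input position `q`; a leaf is its own child. -/
def descend (q : ℕ) (v : ℕ × ℕ) : ℕ × ℕ :=
  if 2 ≤ v.2 then
    if q < v.1 + v.2 / 2 then (v.1, v.2 / 2) else (v.1 + v.2 / 2, v.2 - v.2 / 2)
  else v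

/-- The node at depth `k` on the path from the root to the leaf `q`. -/
def nodeAt (m q k : ℕ) : ℕ × ℕ := (descend q)^[k] (0, m)

lemma nodeAt_succ (m q k : ℕ) : nodeAt m q (k + 1) = descend q (nodeAt m q k) :=
  Function.iterate_succ_apply' _ _ _

lemma isNode_nodeAt (m q k : ℕ) : IsNode m (nodeAt m q k).1 (nodeAt m q k).2 := by
  induction k with
  | zero => exact .root
  | succ k ih =>
    rw [nodeAt_succ, descend]
    split_ifs with h h'
    · exact .left _ _ ih h
    · exact .right _ _ ih h
    · exact ih

lemma IsNode.le {m lo len : ℕ} (h : IsNode m lo len) : lo + len ≤ m := by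
  induction h <;> omega

/-- Each descent shortens the interval by at least one, so depth plus length never exceeds `m`. This
crude bound makes depths below `m` suffice for the enumeration of the inner nodes. -/
lemma IsNode.exists_nodeAt {m lo len : ℕ} (h : IsNode m lo len) :
    ∃ k, k + len ≤ m ∧ ∀ q, lo ≤ q → q < lo + len → nodeAt m q k = (lo, len) := by
  induction h with
  | root => exact ⟨0, by omega, fun q _ _ => rfl⟩
  | left lo len _ h2 ih =>
    obtain ⟨k, hk, h⟩ := ih
    refine ⟨k + 1, by omega, fun q h1 h3 => ?_⟩
    rw [nodeAt_succ, h q h1 (by omega), descend, if_pos h2, if_pos h3]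
  | right lo len _ h2 ih =>
    obtain ⟨k, hk, h⟩ := ih
    refine ⟨k + 1, by omega, fun q h1 h3 => ?_⟩
    rw [nodeAt_succ, h q (by omega) (by omega), descend, if_pos h2, if_neg (not_lt.2 h1)]

/-- The inner nodes are the nodes with at least two inputs on the paths to the leaves. -/
lemma exists_nodeAt_iff {m lo len : ℕ} (h2 : 2 ≤ len) :
    (∃ q < m, ∃ k < m, nodeAt m q k = (lo, len)) ↔ IsNode m lo len := by
  constructor
  · rintro ⟨q, _, k, _, h⟩
    have := isNode_nodeAt m q k
    rwa [h] at this
  · intro h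
    have := h.le
    obtain ⟨k, hk, hq⟩ := h.exists_nodeAt
    exact ⟨lo, by omega, k, by omega, hq lo le_rfl (by omega)⟩

section lists

variable {X : Type} (x : ℕ → Literal X) (t : ℕ → ℕ → ℕ → X)

/-- The literals of `posPart`. -/
def posList (lo len s : ℕ) : List (Literal X) := if s ≤ len then [output x t lo len s] else []

/-- The literals of `negPart`. -/
def negList (lo len s : ℕ) : List (Literal X) := if 1 ≤ s then [(output x t lo len s).neg] else []

/-- The clauses of an inner node. -/
def nodeList (lo len : ℕ) : List (List (Literal X)) :=
  forBelow (len / 2 + 1) fun α => forBelow (len - len / 2 + 1) fun β =>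
    (if 1 ≤ α + β then [negList x t lo (len / 2) α ++
      (negList x t (lo + len / 2) (len - len / 2) β ++ [output x t lo len (α + β)])] else []) ++
    if α + β < len then [posList x t lo (len / 2) (α + 1) ++
      (posList x t (lo + len / 2) (len - len / 2) (β + 1) ++
        [(output x t lo len (α + β + 1)).neg])] else []

/-- The clauses of the totalizer constraint. -/
def atMostList (m d : ℕ) : List (List (Literal X)) :=
  (forBelow m fun q => forBelow m fun k =>
    if 2 ≤ (nodeAt m q k).2 then nodeList x t (nodeAt m q k).1 (nodeAt m q k).2 else []) ++
  forBelow (m + 1) fun s => if d < s then [[(output x t 0 m s).neg]] else []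

lemma clausesOf_nodeList (lo len : ℕ) :
    clausesOf (nodeList x t lo len) = upClauses x t lo len ∪ downClauses x t lo len := by
  have e1 : ∀ lo len s, {l | l ∈ posList x t lo len s} = posPart x t lo len s := by
    intro lo len s; ext l; by_cases h : s ≤ len <;> simp [posList, posPart, h]
  have e2 : ∀ lo len s, {l | l ∈ negList x t lo len s} = negPart x t lo len s := by
    intro lo len s; ext l; by_cases h : 1 ≤ s <;> simp [negList, negPart, h]
  have e3 : ∀ a b c : List (Literal X), {l | l ∈ a ++ (b ++ c)} =
      ({l | l ∈ a} ∪ {l | l ∈ b}) ∪ {l | l ∈ c} := by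
    intro a b c; ext l; simp [or_assoc]
  ext C
  simp only [nodeList, mem_clausesOf_forBelow, clausesOf_append, Set.mem_union, mem_clausesOf_ite,
    e3, e1, e2, List.mem_singleton, Set.ofPred_eq_eq_singleton, upClauses, downClauses,
    Set.mem_ofPred_eq, Nat.lt_succ_iff]
  constructor
  · rintro ⟨α, hα, β, hβ, h | h⟩
    · exact Or.inl ⟨α, β, hα, hβ, h⟩
    · exact Or.inr ⟨α, β, hα, hβ, h⟩
  · rintro (⟨α, β, hα, hβ, h⟩ | ⟨α, β, hα, hβ, h⟩)
    · exact ⟨α, hα, β, hβ, Or.inl h⟩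
    · exact ⟨α, hα, β, hβ, Or.inr h⟩

lemma clausesOf_atMostList (m d : ℕ) : clausesOf (atMostList x t m d) = atMost x t m d := by
  ext C
  simp only [atMostList, atMost, clausesOf_append, Set.mem_union, mem_clausesOf_forBelow,
    mem_clausesOf_ite, List.mem_singleton, Set.ofPred_eq_eq_singleton, Set.mem_ofPred_eq,
    Nat.lt_succ_iff]
  refine or_congr ?_ ⟨fun ⟨s, h1, h2, h3⟩ => ⟨s, h2, h1, h3⟩, fun ⟨s, h1, h2, h3⟩ => ⟨s, h2, h1, h3⟩⟩
  have e : ∀ v : ℕ × ℕ, (C ∈ clausesOf (if 2 ≤ v.2 then nodeList x t v.1 v.2 else [])) ↔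
      2 ≤ v.2 ∧ (C ∈ upClauses x t v.1 v.2 ∨ C ∈ downClauses x t v.1 v.2) := by
    intro v
    by_cases h : 2 ≤ v.2
    · simp [h, clausesOf_nodeList]
    · simp [h, clausesOf]
  simp only [e]
  constructor
  · rintro ⟨q, _, k, _, h, h'⟩
    exact ⟨_, _, isNode_nodeAt m q k, h, h'⟩
  · rintro ⟨lo, len, h, h2, h'⟩
    -- A node may be listed for several `q`, and its clauses repeatedly; only the set of clauses
    -- counts.
    obtain ⟨q, hq, k, hk, e⟩ := (exists_nodeAt_iff h2).2 h
    exact ⟨q, hq, k, hk, by rw [e]; exact ⟨h2, h'⟩⟩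

end lists

end Totalizer

/-! ### Explicit lists for the clause families. -/

namespace RelEncoding

/-- The clauses of `transitivity`. -/
def transitivityList (n : ℕ) : List (List (Literal RelVar)) :=
  forBelow n fun i => forBelow n fun j => forBelow n fun k =>
    if i ≠ j ∧ i ≠ k ∧ j ≠ k then [[(oStar i j).neg, (oStar j k).neg, oStar i k]] else []

/-- The clauses of `atLeastOneParent`. -/
def atLeastOneParentList (n : ℕ) : List (List (Literal RelVar)) :=
  forBelow n fun i => if i + 1 < n then
    [forBelow n fun j => if i < j then [pLit i j] else []] else []

/-- The clauses of `atMostOneParent`. -/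
def atMostOneParentList (n : ℕ) : List (List (Literal RelVar)) :=
  forBelow n fun i => forBelow n fun j => forBelow n fun k =>
    if i < j ∧ i < k ∧ j ≠ k then [[(pLit i j).neg, (pLit i k).neg]] else []

/-- The clauses of `parentLater`. -/
def parentLaterList (n : ℕ) : List (List (Literal RelVar)) :=
  forBelow n fun i => forBelow n fun j => if i < j then [[(pLit i j).neg, oStar i j]] else []

/-- The clauses of `auxiliary`. -/
def auxiliaryList (n : ℕ) : List (List (Literal RelVar)) :=
  forBelow n fun i => forBelow n fun j => forBelow n fun k =>
    if i ≠ j ∧ i ≠ k ∧ j ≠ k ∧ i < j then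
      [[(oStar i j).neg, (oStar i k).neg, (rStar i j k).neg, aStar j k]] else []

/-- The clauses of `create`; `g` is the adjacency matrix. -/
def createList (n : ℕ) (g : ℕ → ℕ → ℕ) : List (List (Literal RelVar)) :=
  forBelow n fun i => forBelow n fun j => forBelow n fun k =>
    if i < j ∧ k ≠ i ∧ k ≠ j ∧ g i k ≠ g j k then
      [[(pLit i j).neg, (oStar i k).neg, rStar i j k]] else []

/-- The clauses of `transfer`. -/
def transferList (n : ℕ) : List (List (Literal RelVar)) :=
  forBelow n fun i => forBelow n fun j => forBelow n fun k =>
    if i ≠ j ∧ i ≠ k ∧ j ≠ k ∧ i < j then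
      [[(pLit i j).neg, (oStar i k).neg, (aStar i k).neg, rStar i j k]] else []

/-- The clauses of `keep`. -/
def keepList (n : ℕ) : List (List (Literal RelVar)) :=
  forBelow n fun i => forBelow n fun j => forBelow n fun k => forBelow n fun m =>
    if i ≠ j ∧ i ≠ k ∧ i ≠ m ∧ j ≠ k ∧ j ≠ m ∧ k ≠ m ∧ k < m then
      [[(oStar i j).neg, (oStar j k).neg, (oStar j m).neg, (rStar i k m).neg, rStar j k m]] else []

/-- The clauses of `cardinality`. -/
def cardinalityList (n d : ℕ) : List (List (Literal RelVar)) :=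
  forBelow n fun i => forBelow n fun j => if i ≠ j then
    Totalizer.atMostList (cardInput i j) (RelVar.t i j) (n - 1) d else []

/-- The clauses of `F(G, d)`, where `g` is the adjacency matrix of `G`. -/
def relEncodingList (n d : ℕ) (g : ℕ → ℕ → ℕ) : List (List (Literal RelVar)) :=
  transitivityList n ++ atLeastOneParentList n ++ atMostOneParentList n ++ parentLaterList n ++
    auxiliaryList n ++ createList n g ++ transferList n ++ keepList n ++ cardinalityList n d

lemma setOf_mem_cons {α : Type} (a : α) (l : List α) :
    {x | x ∈ a :: l} = insert a {x | x ∈ l} := by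
  ext; simp

lemma isListingOf_relEncodingList {n : ℕ} (G : SimpleGraph (Fin n)) (d : ℕ) (g : ℕ → ℕ → ℕ)
    (hg : ∀ i j k : Fin n, g i k ≠ g j k ↔ ¬ (G.Adj i k ↔ G.Adj j k)) :
    IsListingOf (relEncodingList n d g) (relEncoding G d) := by
  show clausesOf _ = _
  have e0 : {x : Literal RelVar | x ∈ ([] : List (Literal RelVar))} = ∅ := by ext; simp
  have ne : ∀ i j : Fin n, (i : ℕ) ≠ j ↔ i ≠ j := fun i j => by rw [Ne, Fin.val_inj]
  have fin : ∀ p : ℕ → Prop, (∃ i < n, p i) ↔ ∃ i : Fin n, p i := fun p =>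
    ⟨fun ⟨i, hi, h⟩ => ⟨⟨i, hi⟩, h⟩, fun ⟨i, h⟩ => ⟨i, i.2, h⟩⟩
  simp only [relEncodingList, relEncoding, clausesOf_append]
  congr 1; congr 1; congr 1; congr 1; congr 1; congr 1; congr 1; congr 1
  · ext C
    simp only [transitivityList, mem_clausesOf_forBelow, mem_clausesOf_ite, setOf_mem_cons, e0,
      fin, ne, transitivity, Set.mem_ofPred_eq, insert_empty_eq, and_assoc]
  · ext C
    simp only [atLeastOneParentList, mem_clausesOf_forBelow, mem_clausesOf_ite,
      fin, atLeastOneParent, Set.mem_ofPred_eq]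
    have : ∀ i : Fin n, {l | l ∈ forBelow n fun j => if (i : ℕ) < j then [pLit i j] else []} =
        {l | ∃ j : Fin n, i < j ∧ l = pLit i j} := by
      intro i; ext l
      simp only [Set.mem_ofPred_eq, mem_forBelow, fin, Fin.lt_def]
      refine exists_congr fun j => ?_
      by_cases h : (i : ℕ) < j <;> simp [h]
    simp only [this]
  · ext C
    simp only [atMostOneParentList, mem_clausesOf_forBelow, mem_clausesOf_ite, setOf_mem_cons, e0,
      fin, ne, atMostOneParent, Set.mem_ofPred_eq, insert_empty_eq, and_assoc, Fin.lt_def]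
  · ext C
    simp only [parentLaterList, mem_clausesOf_forBelow, mem_clausesOf_ite, setOf_mem_cons, e0,
      fin, parentLater, Set.mem_ofPred_eq, insert_empty_eq, Fin.lt_def]
  · ext C
    simp only [auxiliaryList, mem_clausesOf_forBelow, mem_clausesOf_ite, setOf_mem_cons, e0,
      fin, ne, auxiliary, Set.mem_ofPred_eq, insert_empty_eq, and_assoc, Fin.lt_def]
  · ext C
    simp only [createList, mem_clausesOf_forBelow, mem_clausesOf_ite, setOf_mem_cons, e0,
      fin, ne, create, Set.mem_ofPred_eq, insert_empty_eq, Fin.lt_def, hg]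
    refine exists_congr fun i => exists_congr fun j => exists_congr fun k => ?_
    simp only [Set.mem_sdiff, Set.mem_symmDiff, SimpleGraph.mem_neighborSet, Set.mem_insert_iff,
      Set.mem_singleton_iff]
    tauto
  · ext C
    simp only [transferList, mem_clausesOf_forBelow, mem_clausesOf_ite, setOf_mem_cons, e0,
      fin, ne, transfer, Set.mem_ofPred_eq, insert_empty_eq, and_assoc, Fin.lt_def]
  · ext C
    simp only [keepList, mem_clausesOf_forBelow, mem_clausesOf_ite, setOf_mem_cons, e0,
      fin, ne, keep, Set.mem_ofPred_eq, insert_empty_eq, and_assoc, Fin.lt_def]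
  · ext C
    simp only [cardinalityList, mem_clausesOf_forBelow, fin, cardinality, Set.mem_ofPred_eq]
    refine exists_congr fun i => exists_congr fun j => ?_
    by_cases h : (i : ℕ) ≠ j
    · rw [if_pos h, Totalizer.clausesOf_atMostList]
      simp [(ne i j).1 h]
    · rw [if_neg h]
      rw [ne] at h
      simp [h, clausesOf]

end RelEncoding

/-! ## Printing the clauses -/

namespace RAM

/-! ### Computing the nodes of the totalizer tree. -/

section nodeAt

open Totalizer

variable {b : ℕ} {m q k : (ℕ → ℕ) → (ℕ → ℕ) → ℕ}

lemma nodeAt_le (m q k : ℕ) : (nodeAt m q k).1 ≤ m ∧ (nodeAt m q k).2 ≤ m := by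
  have := (isNode_nodeAt m q k).le
  omega

lemma nodeAt_succ_fst (m q k : ℕ) : (nodeAt m q (k + 1)).1 =
    if 2 ≤ (nodeAt m q k).2 then if q < (nodeAt m q k).1 + (nodeAt m q k).2 / 2 then
      (nodeAt m q k).1 else (nodeAt m q k).1 + (nodeAt m q k).2 / 2 else (nodeAt m q k).1 := by
  rw [nodeAt_succ, descend]
  split_ifs <;> rfl

lemma nodeAt_succ_snd (m q k : ℕ) : (nodeAt m q (k + 1)).2 =
    if 2 ≤ (nodeAt m q k).2 then if q < (nodeAt m q k).1 + (nodeAt m q k).2 / 2 then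
      (nodeAt m q k).2 / 2 else (nodeAt m q k).2 - (nodeAt m q k).2 / 2 else (nodeAt m q k).2 := by
  rw [nodeAt_succ, descend]
  split_ifs <;> rfl

lemma Evaluates.nodeAt_fst (hm : Evaluates b m) (hq : Evaluates b q) (hk : Evaluates b k) :
    Evaluates b fun ρ μ => (nodeAt (m ρ μ) (q ρ μ) (k ρ μ)).1 := by
  refine Evaluates.iterate
    (s₁ := fun c ρ μ => if 2 ≤ ρ (c + 1) then if q ρ μ < ρ c + ρ (c + 1) / 2 then ρ c else
      ρ c + ρ (c + 1) / 2 else ρ c)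
    (s₂ := fun c ρ μ => if 2 ≤ ρ (c + 1) then if q ρ μ < ρ c + ρ (c + 1) / 2 then ρ (c + 1) / 2 else
      ρ (c + 1) - ρ (c + 1) / 2 else ρ (c + 1))
    (fun ρ μ t => (nodeAt (m ρ μ) (q ρ μ) t).1) (fun ρ μ t => (nodeAt (m ρ μ) (q ρ μ) t).2)
    (.const 0) hm hk hm (.const 1) ?_ ?_ (fun _ _ => rfl) (fun _ _ => rfl) ?_ ?_ ?_ ?_ ?_
  · intro c hc
    have h0 : Evaluates (c + 3) fun ρ _ => ρ c := .reg (by omega)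
    have h1 : Evaluates (c + 3) fun ρ _ => ρ (c + 1) := .reg (by omega)
    exact .ite (.le (.const 2) h1) (.ite (.lt (hq.mono (by omega)) (h0.add h1.half)) h0
      (h0.add h1.half)) h0
  · intro c hc
    have h0 : Evaluates (c + 3) fun ρ _ => ρ c := .reg (by omega)
    have h1 : Evaluates (c + 3) fun ρ _ => ρ (c + 1) := .reg (by omega)
    exact .ite (.le (.const 2) h1) (.ite (.lt (hq.mono (by omega)) (h0.add h1.half)) h1.half
      (h1.sub h1.half)) h1
  · intro c ρ ρ' μ t _ hr hx hy
    simp only [hx, hy, hq.isLocal _ _ _ hr, nodeAt_succ_fst]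
  · intro c ρ ρ' μ t _ hr hx hy
    simp only [hx, hy, hq.isLocal _ _ _ hr, nodeAt_succ_snd]
  · intro ρ μ t _
    simpa using (nodeAt_le _ _ _).1
  · intro ρ μ t _
    simpa using (nodeAt_le _ _ _).2
  · intro ρ ρ' μ hr
    simp only [hm.isLocal _ _ _ hr, hq.isLocal _ _ _ hr, hk.isLocal _ _ _ hr]

/-- `Evaluates.iterate` returns its first state variable only, so the same iteration is run with the
two components exchanged. -/
lemma Evaluates.nodeAt_snd (hm : Evaluates b m) (hq : Evaluates b q) (hk : Evaluates b k) :
    Evaluates b fun ρ μ => (nodeAt (m ρ μ) (q ρ μ) (k ρ μ)).2 := by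
  refine Evaluates.iterate
    (s₂ := fun c ρ μ => if 2 ≤ ρ c then if q ρ μ < ρ (c + 1) + ρ c / 2 then ρ (c + 1) else
      ρ (c + 1) + ρ c / 2 else ρ (c + 1))
    (s₁ := fun c ρ μ => if 2 ≤ ρ c then if q ρ μ < ρ (c + 1) + ρ c / 2 then ρ c / 2 else
      ρ c - ρ c / 2 else ρ c)
    (fun ρ μ t => (nodeAt (m ρ μ) (q ρ μ) t).2) (fun ρ μ t => (nodeAt (m ρ μ) (q ρ μ) t).1)
    hm (.const 0) hk hm (.const 1) ?_ ?_ (fun _ _ => rfl) (fun _ _ => rfl) ?_ ?_ ?_ ?_ ?_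
  · intro c hc
    have h1 : Evaluates (c + 3) fun ρ _ => ρ c := .reg (by omega)
    have h0 : Evaluates (c + 3) fun ρ _ => ρ (c + 1) := .reg (by omega)
    exact .ite (.le (.const 2) h1) (.ite (.lt (hq.mono (by omega)) (h0.add h1.half)) h1.half
      (h1.sub h1.half)) h1
  · intro c hc
    have h1 : Evaluates (c + 3) fun ρ _ => ρ c := .reg (by omega)
    have h0 : Evaluates (c + 3) fun ρ _ => ρ (c + 1) := .reg (by omega)
    exact .ite (.le (.const 2) h1) (.ite (.lt (hq.mono (by omega)) (h0.add h1.half)) h0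
      (h0.add h1.half)) h0
  · intro c ρ ρ' μ t _ hr hx hy
    simp only [hx, hy, hq.isLocal _ _ _ hr, nodeAt_succ_snd]
  · intro c ρ ρ' μ t _ hr hx hy
    simp only [hx, hy, hq.isLocal _ _ _ hr, nodeAt_succ_fst]
  · intro ρ μ t _
    simpa using (nodeAt_le _ _ _).2
  · intro ρ μ t _
    simpa using (nodeAt_le _ _ _).1
  · intro ρ ρ' μ hr
    simp only [hm.isLocal _ _ _ hr, hq.isLocal _ _ _ hr, hk.isLocal _ _ _ hr]

end nodeAt

/-- The literal `f` can be printed in polynomial time. -/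
def EmitsLiteral (b : ℕ) (f : (ℕ → ℕ) → (ℕ → ℕ) → Literal RelVar) : Prop :=
  Evaluates b (fun ρ μ => if (f ρ μ).pos then 1 else 2) ∧ Emits b fun ρ μ => encodeVar (f ρ μ).var

/-- The literals `f` can be printed in polynomial time. -/
def EmitsLiterals (b : ℕ) (f : (ℕ → ℕ) → (ℕ → ℕ) → List (Literal RelVar)) : Prop :=
  Emits b fun ρ μ => (f ρ μ).flatMap encodeLiteral

/-- The clauses `f` can be printed in polynomial time. -/
def EmitsClauses (b : ℕ) (f : (ℕ → ℕ) → (ℕ → ℕ) → List (List (Literal RelVar))) : Prop :=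
  Emits b fun ρ μ => encodeCNF (f ρ μ)

namespace EmitsLiteral

variable {b : ℕ} {f g : (ℕ → ℕ) → (ℕ → ℕ) → Literal RelVar}

lemma neg (hf : EmitsLiteral b f) : EmitsLiteral b fun ρ μ => (f ρ μ).neg :=
  -- The signs are written `1` and `2`, and subtraction from `3` exchanges them.
  ⟨((Evaluates.const 3).sub hf.1).congr fun ρ μ => by
    cases h : (f ρ μ).pos <;> simp [Literal.neg, h], hf.2⟩

lemma ite {p : (ℕ → ℕ) → (ℕ → ℕ) → Prop} [∀ ρ μ, Decidable (p ρ μ)] (hp : Decides b p)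
    (hf : EmitsLiteral b f) (hg : EmitsLiteral b g) :
    EmitsLiteral b fun ρ μ => if p ρ μ then f ρ μ else g ρ μ :=
  ⟨(Evaluates.ite hp hf.1 hg.1).congr fun ρ μ => by by_cases h : p ρ μ <;> simp [h],
    (Emits.ite hp hf.2 hg.2).congr fun ρ μ => by by_cases h : p ρ μ <;> simp [h]⟩

lemma of_var {v : (ℕ → ℕ) → (ℕ → ℕ) → RelVar} (hv : Emits b fun ρ μ => encodeVar (v ρ μ))
    (s : Bool) : EmitsLiteral b fun ρ μ => ⟨v ρ μ, s⟩ :=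
  ⟨(Evaluates.const (if s then 1 else 2)).congr fun _ _ => rfl, hv⟩

variable {i j k lo len s : (ℕ → ℕ) → (ℕ → ℕ) → ℕ}

open RelEncoding

lemma oStar (hi : Evaluates b i) (hj : Evaluates b j) :
    EmitsLiteral b fun ρ μ => oStar (i ρ μ) (j ρ μ) :=
  have h {i j : (ℕ → ℕ) → (ℕ → ℕ) → ℕ} (hi : Evaluates b i) (hj : Evaluates b j) :
      Emits b fun ρ μ => encodeVar (.o (i ρ μ) (j ρ μ)) :=
    .cons (.const 1) (.cons hi (.cons hj (.cons (.const 0) (.cons (.const 0)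
      (.cons (.const 0) .nil)))))
  ite (.lt hi hj) (of_var (h hi hj) true) (of_var (h hj hi) false)

lemma aStar (hi : Evaluates b i) (hj : Evaluates b j) :
    EmitsLiteral b fun ρ μ => aStar (i ρ μ) (j ρ μ) :=
  have h {i j : (ℕ → ℕ) → (ℕ → ℕ) → ℕ} (hi : Evaluates b i) (hj : Evaluates b j) :
      Emits b fun ρ μ => encodeVar (.a (i ρ μ) (j ρ μ)) :=
    .cons (.const 0) (.cons hi (.cons hj (.cons (.const 0) (.cons (.const 0)
      (.cons (.const 0) .nil)))))
  ite (.lt hi hj) (of_var (h hi hj) true) (of_var (h hj hi) true)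

lemma rStar (hi : Evaluates b i) (hj : Evaluates b j) (hk : Evaluates b k) :
    EmitsLiteral b fun ρ μ => rStar (i ρ μ) (j ρ μ) (k ρ μ) :=
  have h {j k : (ℕ → ℕ) → (ℕ → ℕ) → ℕ} (hj : Evaluates b j) (hk : Evaluates b k) :
      Emits b fun ρ μ => encodeVar (.r (i ρ μ) (j ρ μ) (k ρ μ)) :=
    .cons (.const 3) (.cons hi (.cons hj (.cons hk (.cons (.const 0)
      (.cons (.const 0) .nil)))))
  ite (.lt hj hk) (of_var (h hj hk) true) (of_var (h hk hj) true)

lemma pLit (hi : Evaluates b i) (hj : Evaluates b j) :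
    EmitsLiteral b fun ρ μ => pLit (i ρ μ) (j ρ μ) :=
  of_var (.cons (.const 2) (.cons hi (.cons hj (.cons (.const 0) (.cons (.const 0)
      (.cons (.const 0) .nil)))))) true

lemma output (hi : Evaluates b i) (hj : Evaluates b j) (hlo : Evaluates b lo)
    (hlen : Evaluates b len) (hs : Evaluates b s) :
    EmitsLiteral b fun ρ μ => Totalizer.output (cardInput (i ρ μ) (j ρ μ))
      (RelVar.t (i ρ μ) (j ρ μ)) (lo ρ μ) (len ρ μ) (s ρ μ) :=
  ite (.eq hlen (.const 1))
    (rStar hi hj (.ite (.lt hlo hj) hlo (hlo.add (.const 1))))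
    (of_var (.cons (.const 4) (.cons hi (.cons hj (.cons hlo (.cons hlen (.cons hs .nil)))))) true)

end EmitsLiteral

namespace EmitsLiterals

variable {b : ℕ} {f g : (ℕ → ℕ) → (ℕ → ℕ) → List (Literal RelVar)}

lemma nil : EmitsLiterals b fun _ _ => [] := Emits.nil

lemma cons {l : (ℕ → ℕ) → (ℕ → ℕ) → Literal RelVar} (hl : EmitsLiteral b l)
    (hf : EmitsLiterals b f) : EmitsLiterals b fun ρ μ => l ρ μ :: f ρ μ :=
  ((Emits.cons hl.1 hl.2).append hf).congr fun _ _ => List.flatMap_cons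

lemma append (hf : EmitsLiterals b f) (hg : EmitsLiterals b g) :
    EmitsLiterals b fun ρ μ => f ρ μ ++ g ρ μ :=
  (Emits.append hf hg).congr fun _ _ => List.flatMap_append

lemma ite {p : (ℕ → ℕ) → (ℕ → ℕ) → Prop} [∀ ρ μ, Decidable (p ρ μ)] (hp : Decides b p)
    (hf : EmitsLiterals b f) (hg : EmitsLiterals b g) :
    EmitsLiterals b fun ρ μ => if p ρ μ then f ρ μ else g ρ μ :=
  (Emits.ite hp hf hg).congr fun ρ μ => by by_cases h : p ρ μ <;> simp [h]

lemma forBelow {N : (ℕ → ℕ) → (ℕ → ℕ) → ℕ} {F : (ℕ → ℕ) → (ℕ → ℕ) → ℕ → List (Literal RelVar)}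
    (hN : Evaluates b N) (hF : EmitsLiterals (b + 1) fun ρ μ => F ρ μ (ρ b))
    (hloc : ∀ v, IsLocal b fun ρ μ => F ρ μ v) :
    EmitsLiterals b fun ρ μ => forBelow (N ρ μ) (F ρ μ) :=
  (Emits.flatMap (F := fun ρ μ v => (F ρ μ v).flatMap encodeLiteral) hN hF fun v ρ ρ' μ hr =>
    congrArg (List.flatMap encodeLiteral) (hloc v ρ ρ' μ hr)).congr fun _ _ => List.flatMap_assoc

end EmitsLiterals

namespace EmitsClauses

variable {b : ℕ} {f g : (ℕ → ℕ) → (ℕ → ℕ) → List (List (Literal RelVar))}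

lemma append (hf : EmitsClauses b f) (hg : EmitsClauses b g) :
    EmitsClauses b fun ρ μ => f ρ μ ++ g ρ μ :=
  (Emits.append hf hg).congr fun _ _ => List.flatMap_append

lemma ite {p : (ℕ → ℕ) → (ℕ → ℕ) → Prop} [∀ ρ μ, Decidable (p ρ μ)] (hp : Decides b p)
    (hf : EmitsClauses b f) :
    EmitsClauses b fun ρ μ => if p ρ μ then f ρ μ else [] :=
  (Emits.ite hp hf Emits.nil).congr fun ρ μ => by by_cases h : p ρ μ <;> simp [h, encodeCNF]

/-- One clause, if a condition is satisfied. -/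
lemma single {p : (ℕ → ℕ) → (ℕ → ℕ) → Prop} [∀ ρ μ, Decidable (p ρ μ)]
    {c : (ℕ → ℕ) → (ℕ → ℕ) → List (Literal RelVar)} (hp : Decides b p) (hc : EmitsLiterals b c) :
    EmitsClauses b fun ρ μ => if p ρ μ then [c ρ μ] else [] :=
  ite hp <| (Emits.append hc (Emits.singleton (.const 0))).congr fun _ _ => by
    simp [encodeCNF, encodeClause]

lemma forBelow {N : (ℕ → ℕ) → (ℕ → ℕ) → ℕ}
    {F : (ℕ → ℕ) → (ℕ → ℕ) → ℕ → List (List (Literal RelVar))}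
    (hN : Evaluates b N) (hF : EmitsClauses (b + 1) fun ρ μ => F ρ μ (ρ b))
    (hloc : ∀ v, IsLocal b fun ρ μ => F ρ μ v) :
    EmitsClauses b fun ρ μ => forBelow (N ρ μ) (F ρ μ) :=
  (Emits.flatMap (F := fun ρ μ v => encodeCNF (F ρ μ v)) hN hF fun v ρ ρ' μ hr =>
    congrArg encodeCNF (hloc v ρ ρ' μ hr)).congr fun _ _ => List.flatMap_assoc

open RelEncoding

section lists

lemma card {b : ℕ} : Evaluates b fun _ μ => μ 0 := .load (.const 0)

lemma bound {b : ℕ} : Evaluates b fun _ μ => μ 1 := .load (.const 1)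

lemma transitivityList : EmitsClauses 0 fun _ μ => transitivityList (μ 0) := by
  -- Nested loops keep their indices in registers `0`, `1`, `2` from the outside inwards, so the
  -- innermost body protects three registers.
  have hi : Evaluates 3 fun ρ _ => ρ 0 := .reg (by omega)
  have hj : Evaluates 3 fun ρ _ => ρ 1 := .reg (by omega)
  have hk : Evaluates 3 fun ρ _ => ρ 2 := .reg (by omega)
  refine forBelow card (forBelow card (forBelow card (single ?_ ?_) ?_) ?_) ?_
  · exact .and (.ne hi hj) (.and (.ne hi hk) (.ne hj hk))
  · exact .cons (.neg (.oStar hi hj)) (.cons (.neg (.oStar hj hk)) (.cons (.oStar hi hk) .nil))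
  all_goals (intro v ρ ρ' μ hr; simp [hr])

lemma atLeastOneParentList : EmitsClauses 0 fun _ μ => atLeastOneParentList (μ 0) := by
  have hi {b : ℕ} (h : 0 < b) : Evaluates b fun ρ _ => ρ 0 := .reg h
  have hj : Evaluates 2 fun ρ _ => ρ 1 := .reg (by omega)
  refine forBelow card (single ?_ ?_) ?_
  · exact .lt ((hi (by omega)).add (.const 1)) card
  · refine .forBelow card (.ite (.lt (hi (by omega)) hj) (.cons (.pLit (hi (by omega)) hj) .nil)
      .nil) ?_
    intro v ρ ρ' μ hr; simp [hr]
  intro v ρ ρ' μ hr; rfl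

lemma atMostOneParentList : EmitsClauses 0 fun _ μ => atMostOneParentList (μ 0) := by
  have hi : Evaluates 3 fun ρ _ => ρ 0 := .reg (by omega)
  have hj : Evaluates 3 fun ρ _ => ρ 1 := .reg (by omega)
  have hk : Evaluates 3 fun ρ _ => ρ 2 := .reg (by omega)
  refine forBelow card (forBelow card (forBelow card (single ?_ ?_) ?_) ?_) ?_
  · exact .and (.lt hi hj) (.and (.lt hi hk) (.ne hj hk))
  · exact .cons (.neg (.pLit hi hj)) (.cons (.neg (.pLit hi hk)) .nil)
  all_goals (intro v ρ ρ' μ hr; simp [hr])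

lemma parentLaterList : EmitsClauses 0 fun _ μ => parentLaterList (μ 0) := by
  have hi : Evaluates 2 fun ρ _ => ρ 0 := .reg (by omega)
  have hj : Evaluates 2 fun ρ _ => ρ 1 := .reg (by omega)
  refine forBelow card (forBelow card (single (.lt hi hj) ?_) ?_) ?_
  · exact .cons (.neg (.pLit hi hj)) (.cons (.oStar hi hj) .nil)
  all_goals (intro v ρ ρ' μ hr; simp [hr])

lemma auxiliaryList : EmitsClauses 0 fun _ μ => auxiliaryList (μ 0) := by
  have hi : Evaluates 3 fun ρ _ => ρ 0 := .reg (by omega)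
  have hj : Evaluates 3 fun ρ _ => ρ 1 := .reg (by omega)
  have hk : Evaluates 3 fun ρ _ => ρ 2 := .reg (by omega)
  refine forBelow card (forBelow card (forBelow card (single ?_ ?_) ?_) ?_) ?_
  · exact .and (.ne hi hj) (.and (.ne hi hk) (.and (.ne hj hk) (.lt hi hj)))
  · exact .cons (.neg (.oStar hi hj)) (.cons (.neg (.oStar hi hk)) (.cons (.neg (.rStar hi hj hk))
      (.cons (.aStar hj hk) .nil)))
  all_goals (intro v ρ ρ' μ hr; simp [hr])

lemma createList :
    EmitsClauses 0 fun _ μ => createList (μ 0) fun i j => μ (2 + i * μ 0 + j) := by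
  have hi : Evaluates 3 fun ρ _ => ρ 0 := .reg (by omega)
  have hj : Evaluates 3 fun ρ _ => ρ 1 := .reg (by omega)
  have hk : Evaluates 3 fun ρ _ => ρ 2 := .reg (by omega)
  refine forBelow card (forBelow card (forBelow card (single ?_ ?_) ?_) ?_) ?_
  · exact .and (.lt hi hj) (.and (.ne hk hi) (.and (.ne hk hj)
      (.ne (.load (.add (.add (.const 2) (.mul hi card)) hk))
        (.load (.add (.add (.const 2) (.mul hj card)) hk)))))
  · exact .cons (.neg (.pLit hi hj)) (.cons (.neg (.oStar hi hk)) (.cons (.rStar hi hj hk) .nil))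
  all_goals (intro v ρ ρ' μ hr; simp [hr])

lemma transferList : EmitsClauses 0 fun _ μ => transferList (μ 0) := by
  have hi : Evaluates 3 fun ρ _ => ρ 0 := .reg (by omega)
  have hj : Evaluates 3 fun ρ _ => ρ 1 := .reg (by omega)
  have hk : Evaluates 3 fun ρ _ => ρ 2 := .reg (by omega)
  refine forBelow card (forBelow card (forBelow card (single ?_ ?_) ?_) ?_) ?_
  · exact .and (.ne hi hj) (.and (.ne hi hk) (.and (.ne hj hk) (.lt hi hj)))
  · exact .cons (.neg (.pLit hi hj)) (.cons (.neg (.oStar hi hk)) (.cons (.neg (.aStar hi hk))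
      (.cons (.rStar hi hj hk) .nil)))
  all_goals (intro v ρ ρ' μ hr; simp [hr])

lemma keepList : EmitsClauses 0 fun _ μ => keepList (μ 0) := by
  have hi : Evaluates 4 fun ρ _ => ρ 0 := .reg (by omega)
  have hj : Evaluates 4 fun ρ _ => ρ 1 := .reg (by omega)
  have hk : Evaluates 4 fun ρ _ => ρ 2 := .reg (by omega)
  have hm : Evaluates 4 fun ρ _ => ρ 3 := .reg (by omega)
  refine forBelow card (forBelow card (forBelow card (forBelow card (single ?_ ?_) ?_) ?_) ?_) ?_
  · exact .and (.ne hi hj) (.and (.ne hi hk) (.and (.ne hi hm) (.and (.ne hj hk) (.and (.ne hj hm)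
      (.and (.ne hk hm) (.lt hk hm))))))
  · exact .cons (.neg (.oStar hi hj)) (.cons (.neg (.oStar hj hk)) (.cons (.neg (.oStar hj hm))
      (.cons (.neg (.rStar hi hk hm)) (.cons (.rStar hj hk hm) .nil))))
  all_goals (intro v ρ ρ' μ hr; simp [hr])

lemma nodeList : EmitsClauses 4 fun ρ μ =>
    Totalizer.nodeList (cardInput (ρ 0) (ρ 1)) (RelVar.t (ρ 0) (ρ 1))
      (Totalizer.nodeAt (μ 0 - 1) (ρ 2) (ρ 3)).1 (Totalizer.nodeAt (μ 0 - 1) (ρ 2) (ρ 3)).2 := by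
  -- Registers `0`, `1` hold the pair `(i, j)`, registers `2`, `3` the leaf and the depth that
  -- specify the node, and registers `4`, `5` the indices `α`, `β`.
  have hi : Evaluates 6 fun ρ _ => ρ 0 := .reg (by omega)
  have hj : Evaluates 6 fun ρ _ => ρ 1 := .reg (by omega)
  have hα : Evaluates 6 fun ρ _ => ρ 4 := .reg (by omega)
  have hβ : Evaluates 6 fun ρ _ => ρ 5 := .reg (by omega)
  have hlo {b : ℕ} (h : 4 ≤ b) :
      Evaluates b fun ρ μ => (Totalizer.nodeAt (μ 0 - 1) (ρ 2) (ρ 3)).1 :=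
    .nodeAt_fst (.sub card (.const 1)) (.reg (by omega)) (.reg (by omega))
  have hlen {b : ℕ} (h : 4 ≤ b) :
      Evaluates b fun ρ μ => (Totalizer.nodeAt (μ 0 - 1) (ρ 2) (ρ 3)).2 :=
    .nodeAt_snd (.sub card (.const 1)) (.reg (by omega)) (.reg (by omega))
  have hlo' := hlo (b := 6) (by omega)
  have hlen' := hlen (b := 6) (by omega)
  refine forBelow (.add (hlen le_rfl).half (.const 1)) (forBelow (.add
    (.sub (hlen (by omega)) (hlen (by omega)).half) (.const 1)) (append (single ?_ ?_)
    (single ?_ ?_)) ?_) ?_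
  · exact .le (.const 1) (hα.add hβ)
  · exact .append (.ite (.le (.const 1) hα) (.cons (.neg (.output hi hj hlo' hlen'.half hα)) .nil)
      .nil) (.append (.ite (.le (.const 1) hβ) (.cons (.neg (.output hi hj (hlo'.add hlen'.half)
      (hlen'.sub hlen'.half) hβ)) .nil) .nil) (.cons (.output hi hj hlo' hlen' (hα.add hβ)) .nil))
  · exact .lt (hα.add hβ) hlen'
  · exact .append (.ite (.le (hα.add (.const 1)) hlen'.half) (.cons (.output hi hj hlo' hlen'.half
      (hα.add (.const 1))) .nil) .nil) (.append (.ite (.le (hβ.add (.const 1))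
      (hlen'.sub hlen'.half)) (.cons (.output hi hj (hlo'.add hlen'.half) (hlen'.sub hlen'.half)
      (hβ.add (.const 1))) .nil) .nil) (.cons (.neg (.output hi hj hlo' hlen'
      ((hα.add hβ).add (.const 1)))) .nil))
  all_goals (intro v ρ ρ' μ hr; simp [hr])

lemma cardinalityList : EmitsClauses 0 fun _ μ => cardinalityList (μ 0) (μ 1) := by
  have hi {b : ℕ} (h : 0 < b) : Evaluates b fun ρ _ => ρ 0 := .reg h
  have hj {b : ℕ} (h : 1 < b) : Evaluates b fun ρ _ => ρ 1 := .reg h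
  have hm {b : ℕ} : Evaluates b fun _ μ => μ 0 - 1 := .sub card (.const 1)
  have hs : Evaluates 3 fun ρ _ => ρ 2 := .reg (by omega)
  refine forBelow card (forBelow card (ite (.ne (hi (by omega)) (hj (by omega))) (append
    (forBelow hm (forBelow hm (ite ?_ nodeList) ?_) ?_)
    (forBelow (.add hm (.const 1)) (single ?_ ?_) ?_))) ?_) ?_
  · exact .le (.const 2) (.nodeAt_snd hm (.reg (by omega)) (.reg (by omega)))
  rotate_left 2
  · exact .lt bound hs
  · exact .cons (.neg (.output (hi (by omega)) (hj (by omega)) (.const 0) hm hs)) .nil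
  all_goals (intro v ρ ρ' μ hr; simp [hr])

lemma relEncodingList :
    EmitsClauses 0 fun _ μ => relEncodingList (μ 0) (μ 1) fun i j => μ (2 + i * μ 0 + j) :=
  .append (.append (.append (.append (.append (.append (.append (.append transitivityList
    atLeastOneParentList) atMostOneParentList) parentLaterList) auxiliaryList) createList)
    transferList) keepList) cardinalityList

end lists

end EmitsClauses

end RAM

/-! ### The input in memory: the adjacency matrix row by row. -/

lemma getD_flatMap_map {α : Type} {n : ℕ} (l l' : List α) (hl' : l'.length = n) (f : α → α → ℕ)
    (i j : ℕ) (hi : i < l.length) (hj : j < l'.length) :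
    (l.flatMap fun a => l'.map (f a)).getD (i * n + j) 0 = f l[i] l'[j] := by
  induction l generalizing i with
  | nil => simp at hi
  | cons a l ih =>
    rw [List.flatMap_cons]
    cases i with
    | zero =>
      rw [List.getD_append _ _ _ _ (by simpa using hj)]
      simp [List.getD_eq_getElem?_getD, hj]
    | succ i =>
      rw [List.getD_append_right _ _ _ _ (by
        simp only [List.length_map, hl', Nat.succ_mul]; omega)]
      have : (i + 1) * n + j - (l'.map (f a)).length = i * n + j := by
        simp only [List.length_map, hl', Nat.succ_mul]; omega
      rw [this, ih i (by simpa using hi)]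
      simp

open Classical in
lemma getD_encodeInput {n : ℕ} (G : SimpleGraph (Fin n)) (d : ℕ) (i j : Fin n) :
    (encodeInput G d).getD (2 + i * n + j) 0 = if G.Adj i j then 1 else 0 := by
  have h : 2 + (i : ℕ) * n + j = (i * n + j) + 1 + 1 := by omega
  rw [encodeInput, h, List.getD_cons_succ, List.getD_cons_succ,
    getD_flatMap_map _ _ (List.length_finRange) (fun i j => if G.Adj i j then 1 else 0) i j
      (by simp) (by simp)]
  simp

/-- Supplies the initial bound `M`: no register is protected at the start, so only memory entries
matter, and matrix entries are at most `1` even when `n + d` is small. -/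
lemma getD_encodeInput_le {n : ℕ} (G : SimpleGraph (Fin n)) (d a : ℕ) :
    (encodeInput G d).getD a 0 ≤ n + d + 1 := by
  have h : ∀ x ∈ encodeInput G d, x ≤ n + d + 1 := by
    intro x hx
    simp only [encodeInput, List.mem_cons, List.mem_flatMap, List.mem_map] at hx
    rcases hx with rfl | rfl | ⟨i, _, j, _, rfl⟩
    · omega
    · omega
    · split_ifs <;> omega
  rw [List.getD_eq_getElem?_getD]
  cases ha : (encodeInput G d)[a]? with
  | none => simp
  | some x => exact h x (List.mem_of_getElem? ha)

lemma exists_prog_relEncoding : ∃ (P : RAM.Prog) (B : Polynomial ℕ),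
    ∀ (n : ℕ) (_ : 1 ≤ n) (G : SimpleGraph (Fin n)) (d : ℕ),
      ∃ (k : ℕ) (cs : List (List (Literal RelVar))),
        k ≤ B.eval (n + d) ∧ P.Computes (encodeInput G d) k (encodeCNF cs) ∧
        IsListingOf cs (relEncoding G d) := by
  obtain ⟨P, B, h⟩ := RAM.EmitsClauses.relEncodingList.runs
  refine ⟨P, B.comp (Polynomial.X + 1), fun n _ G d => ?_⟩
  obtain ⟨k, hk, σ, he, _, ho⟩ := h (RAM.initial (encodeInput G d)) (n + d + 1)
    ⟨fun _ hr => absurd hr (Nat.not_lt_zero _), getD_encodeInput_le G d⟩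
  refine ⟨k, _, by simpa using hk, ⟨σ, he, ho⟩, ?_⟩
  refine RelEncoding.isListingOf_relEncodingList G d _ fun i j k => ?_
  have hadj : ∀ i k : Fin n, (RAM.initial (encodeInput G d)).mem
      (2 + i * (RAM.initial (encodeInput G d)).mem 0 + k) = _ := getD_encodeInput G d
  rw [hadj, hadj]
  by_cases h1 : G.Adj i k <;> by_cases h2 : G.Adj j k <;> simp [h1, h2]

/-! ## The semantics of totalizers -/

lemma Literal.neg_holds {X : Type} {τ : X → Bool} {l : Literal X} :
    l.neg.Holds τ ↔ ¬ l.Holds τ := by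
  cases h : τ l.var <;> cases h' : l.pos <;> simp [Literal.Holds, Literal.neg, h, h']

namespace Totalizer

open Literal

variable {X : Type} (x : ℕ → Literal X) (t : ℕ → ℕ → ℕ → X) (τ : X → Bool)

open Classical in
/-- The number of true inputs in the interval `[lo, lo + len)`. -/
noncomputable def count (lo len : ℕ) : ℕ :=
  ((Finset.range len).filter fun q => (x (lo + q)).Holds τ).card

lemma count_le (lo len : ℕ) : count x τ lo len ≤ len := by
  classical
  exact (Finset.card_filter_le _ _).trans (Finset.card_range len).le

lemma count_one (lo : ℕ) : 1 ≤ count x τ lo 1 ↔ (x lo).Holds τ := by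
  classical
  by_cases h : (x lo).Holds τ <;> simp [count, Finset.filter_singleton, h]

lemma count_add (lo k l : ℕ) :
    count x τ lo (k + l) = count x τ lo k + count x τ (lo + k) l := by
  classical
  simp only [count, Finset.card_filter, Finset.sum_range_add, add_assoc]

lemma count_half (lo len : ℕ) : count x τ lo len =
    count x τ lo (len / 2) + count x τ (lo + len / 2) (len - len / 2) := by
  rw [← count_add]
  congr 1
  omega

variable {x t τ} {m d : ℕ}

/-- The outputs of a satisfied totalizer are true up to the number of true inputs. -/
lemma output_holds (hτ : ∀ C ∈ atMost x t m d, ∃ l ∈ C, l.Holds τ) (len : ℕ) :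
    ∀ lo s, IsNode m lo len → 1 ≤ s → s ≤ count x τ lo len → (output x t lo len s).Holds τ := by
  induction len using Nat.strong_induction_on with
  | _ len ih =>
    intro lo s hnode hs hsc
    have hlen := count_le x τ lo len
    by_cases h1 : len = 1
    · subst h1
      rw [output, if_pos rfl]
      exact (count_one x τ lo).1 (by omega)
    have h2 : 2 ≤ len := by omega
    rw [count_half] at hsc
    have hl := count_le x τ lo (len / 2)
    have hr := count_le x τ (lo + len / 2) (len - len / 2)
    -- Take as many of the `s` true inputs as possible from the left half. The right half then
    -- contains at least `s - α` of them, and the upward clause for `(α, s - α)` has both premises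
    -- true by induction.
    set α := min s (count x τ lo (len / 2)) with hα
    obtain ⟨l, hl, hh⟩ := hτ (negPart x t lo (len / 2) α ∪
      negPart x t (lo + len / 2) (len - len / 2) (s - α) ∪ {output x t lo len (α + (s - α))})
      (Or.inl ⟨lo, len, hnode, h2, Or.inl ⟨α, s - α, by omega, by omega, by omega, rfl⟩⟩)
    rcases hl with (⟨h, rfl⟩ | ⟨h, rfl⟩) | rfl
    · exact absurd (ih _ (by omega) lo α (.left _ _ hnode h2) h (by omega)) (neg_holds.1 hh)
    · exact absurd (ih _ (by omega) _ (s - α) (.right _ _ hnode h2) h (by omega)) (neg_holds.1 hh)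
    · rwa [show α + (s - α) = s by omega] at hh

lemma count_le_of_atMost (hτ : ∀ C ∈ atMost x t m d, ∃ l ∈ C, l.Holds τ) : count x τ 0 m ≤ d := by
  by_contra! h
  have hm := count_le x τ 0 m
  -- More than `d` true inputs would make output `d + 1` true, and it exists because `d + 1 ≤ m`;
  -- but its negation is a unit clause.
  obtain ⟨l, hl, hh⟩ := hτ {(output x t 0 m (d + 1)).neg} (Or.inr ⟨d + 1, by omega, by omega, rfl⟩)
  rw [Set.mem_singleton_iff] at hl
  subst hl
  exact neg_holds.1 hh (output_holds hτ m 0 (d + 1) .root (by omega) h)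

/-- If the auxiliary variables count the true inputs, of which there are at most `d`, then the
totalizer constraint is satisfied. -/
lemma atMost_of_count_le (ht : ∀ lo len s, τ (t lo len s) = true ↔ s ≤ count x τ lo len)
    (hd : count x τ 0 m ≤ d) : ∀ C ∈ atMost x t m d, ∃ l ∈ C, l.Holds τ := by
  have hout : ∀ lo len s, 1 ≤ s → s ≤ len →
      ((output x t lo len s).Holds τ ↔ s ≤ count x τ lo len) := by
    intro lo len s h1 h2
    rw [output]
    split_ifs with h
    · subst h
      rw [← count_one, show s = 1 by omega]
    · exact ht lo len s
  rintro C (⟨lo, len, _, h2, ⟨α, β, hα, hβ, h1, rfl⟩ | ⟨α, β, hα, hβ, h1, rfl⟩⟩ | ⟨s, h1, h2, rfl⟩)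
  · have hc := count_half x τ lo len
    by_cases hα' : α ≤ count x τ lo (len / 2)
    · by_cases hβ' : β ≤ count x τ (lo + len / 2) (len - len / 2)
      · exact ⟨_, Or.inr rfl, (hout _ _ _ h1 (by omega)).2 (by omega)⟩
      · exact ⟨_, Or.inl (Or.inr ⟨by omega, rfl⟩), neg_holds.2 fun h => hβ'
          ((hout _ _ _ (by omega) hβ).1 h)⟩
    · exact ⟨_, Or.inl (Or.inl ⟨by omega, rfl⟩), neg_holds.2 fun h => hα'
        ((hout _ _ _ (by omega) hα).1 h)⟩
  · have hc := count_half x τ lo len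
    have hl := count_le x τ lo (len / 2)
    have hr := count_le x τ (lo + len / 2) (len - len / 2)
    by_cases hα' : α + 1 ≤ count x τ lo (len / 2)
    · exact ⟨_, Or.inl (Or.inl ⟨by omega, rfl⟩), (hout _ _ _ (by omega) (by omega)).2 hα'⟩
    · by_cases hβ' : β + 1 ≤ count x τ (lo + len / 2) (len - len / 2)
      · exact ⟨_, Or.inl (Or.inr ⟨by omega, rfl⟩), (hout _ _ _ (by omega) (by omega)).2 hβ'⟩
      · exact ⟨_, Or.inr rfl, neg_holds.2 fun h => by
          have := (hout _ _ _ (by omega) (by omega)).1 h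
          omega⟩
  · exact ⟨_, rfl, neg_holds.2 fun h => by
      have := (hout _ _ _ (by omega) h2).1 h
      omega⟩

end Totalizer

/-! ## Elimination schemes -/

/-- The red edges after the contraction of `i` into `j`, where the edges that are not red are those
of `G`. -/
def contractRed {n : ℕ} (G R : SimpleGraph (Fin n)) (i j : Fin n) : SimpleGraph (Fin n) where
  Adj x y := x ≠ y ∧ (R.Adj x y ∨ (x = j ∧ (R.Adj i y ∨ ¬ (G.Adj i y ↔ G.Adj j y))) ∨
    (y = j ∧ (R.Adj i x ∨ ¬ (G.Adj i x ↔ G.Adj j x))))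
  symm := ⟨fun x y ⟨h, h'⟩ => ⟨h.symm, by rw [R.adj_comm]; tauto⟩⟩
  loopless := ⟨fun _ h => h.1 rfl⟩

lemma contractRed_adj_left {n : ℕ} {G R : SimpleGraph (Fin n)} {i j y : Fin n} (hy : y ≠ j) :
    (contractRed G R i j).Adj j y ↔ R.Adj j y ∨ R.Adj i y ∨ ¬ (G.Adj i y ↔ G.Adj j y) := by
  simp [contractRed, hy, hy.symm]

lemma contractRed_adj {n : ℕ} {G R : SimpleGraph (Fin n)} {i j x y : Fin n} (hx : x ≠ j)
    (hy : y ≠ j) : (contractRed G R i j).Adj x y ↔ R.Adj x y := by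
  simp only [contractRed, hx, hy, false_and, or_false]
  exact ⟨And.right, fun h => ⟨h.ne, h⟩⟩

lemma le_contractRed {n : ℕ} {G R : SimpleGraph (Fin n)} {i j x y : Fin n} (h : R.Adj x y) :
    (contractRed G R i j).Adj x y := ⟨h.ne, Or.inl h⟩

/-- An elimination ordering `lt` of the vertices in `S`, a contraction tree `p`, red edges `red i`
after the elimination of `i`, and edges `a` that are red at some time. -/
structure IsScheme {n : ℕ} (G : SimpleGraph (Fin n)) (d : ℕ) (S : Set (Fin n))
    (lt p : Fin n → Fin n → Prop) (red : Fin n → Fin n → Fin n → Prop)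
    (a : Fin n → Fin n → Prop) : Prop where
  trans : ∀ i ∈ S, ∀ j ∈ S, ∀ k ∈ S, i ≠ k → lt i j → lt j k → lt i k
  total : ∀ i ∈ S, ∀ j ∈ S, i ≠ j → (lt j i ↔ ¬ lt i j)
  parent : ∀ i ∈ S, (∃ k ∈ S, i < k) → ∃ j ∈ S, i < j ∧ p i j
  parent_unique : ∀ i ∈ S, ∀ j ∈ S, ∀ k ∈ S, i < j → i < k → p i j → p i k → j = k
  parent_later : ∀ i ∈ S, ∀ j ∈ S, i < j → p i j → lt i j
  red_symm : ∀ i j k, red i j k → red i k j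
  a_symm : ∀ i j, a i j → a j i
  auxiliary : ∀ i ∈ S, ∀ j ∈ S, ∀ k ∈ S, i ≠ j → i ≠ k → j ≠ k → i < j → lt i j → lt i k →
    red i j k → a j k
  create : ∀ i ∈ S, ∀ j ∈ S, ∀ k ∈ S, i < j → k ≠ i → k ≠ j → ¬ (G.Adj i k ↔ G.Adj j k) →
    p i j → lt i k → red i j k
  transfer : ∀ i ∈ S, ∀ j ∈ S, ∀ k ∈ S, i ≠ k → j ≠ k → i < j → p i j → lt i k → a i k → red i j k
  keep : ∀ i ∈ S, ∀ j ∈ S, ∀ k ∈ S, ∀ m ∈ S, i ≠ j → i ≠ k → i ≠ m → j ≠ k → j ≠ m → k ≠ m →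
    lt i j → lt j k → lt j m → red i k m → red j k m
  degree : ∀ i ∈ S, ∀ j ∈ S, i ≠ j → {k | k ≠ j ∧ red i j k}.ncard ≤ d

/-- The trigraph `T` has the red edges `R` and, apart from these, the edges of `G`. -/
structure Represents {n : ℕ} {V : Type} (G R : SimpleGraph (Fin n)) (ρ : V → Fin n)
    (T : Trigraph V) : Prop where
  injective : Function.Injective ρ
  red : ∀ x y, T.red.Adj x y ↔ R.Adj (ρ x) (ρ y)
  black : ∀ x y, T.black.Adj x y ↔ G.Adj (ρ x) (ρ y) ∧ ¬ R.Adj (ρ x) (ρ y)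

/-! ### Trigraphs given by a red graph on top of `G`. -/

namespace Represents

variable {n : ℕ} {V : Type} {G R : SimpleGraph (Fin n)} {ρ : V → Fin n} {T : Trigraph V}

/-- The trigraph on `V` that is represented by `ρ` and `R`. -/
def trigraph (G R : SimpleGraph (Fin n)) (ρ : V → Fin n) : Trigraph V where
  black := (G \ R).comap ρ
  red := R.comap ρ
  disjoint := by
    rw [SimpleGraph.disjoint_left]
    rintro x y ⟨_, h⟩
    exact h

lemma trigraph_represents (hρ : Function.Injective ρ) : Represents G R ρ (trigraph G R ρ) :=
  ⟨hρ, fun _ _ => Iff.rfl, fun _ _ => Iff.rfl⟩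

lemma mem_nbrs (h : Represents G R ρ T) {x y : V} :
    y ∈ T.nbrs x ↔ G.Adj (ρ x) (ρ y) ∨ R.Adj (ρ x) (ρ y) := by
  simp only [Trigraph.nbrs, Set.mem_ofPred_eq, h.red, h.black]
  tauto

/-- If the edge from `v` is not red after the contraction, then neither vertex had a red edge to `x`
and `G` agrees on the two edges; so the adjacency of `v` in `G` yields both black edges. -/
lemma black_contract_iff (h : Represents G R ρ T) {u v x : V} (hxv : x ≠ v) :
    G.Adj (ρ v) (ρ x) ∧ ¬ (contractRed G R (ρ u) (ρ v)).Adj (ρ v) (ρ x) ↔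
      T.black.Adj u x ∧ T.black.Adj v x := by
  rw [contractRed_adj_left (h.injective.ne hxv), h.black, h.black]
  tauto

lemma red_contract_iff (h : Represents G R ρ T) {u v x : V} (hxv : x ≠ v) :
    (contractRed G R (ρ u) (ρ v)).Adj (ρ v) (ρ x) ↔ x ∈ T.nbrs u ∆ T.nbrs v ∨
      (x ∈ T.nbrs u ∩ T.nbrs v ∧ ¬ (T.black.Adj u x ∧ T.black.Adj v x)) := by
  rw [contractRed_adj_left (h.injective.ne hxv), Set.mem_symmDiff,
    Set.mem_inter_iff, h.mem_nbrs, h.mem_nbrs, h.black, h.black]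
  tauto

/-- Contracting `u` into `v`. -/
lemma isContraction (h : Represents G R ρ T) {u v : V} (huv : u ≠ v)
    {T' : Trigraph {x // x ≠ u}}
    (h' : Represents G (contractRed G R (ρ u) (ρ v)) (fun x => ρ x.1) T') : T.IsContraction T' := by
  classical
  have hne : ∀ {x y : V}, x ≠ y → ρ x ≠ ρ y := fun hxy hρ => hxy (h.injective hρ)
  let f : V → {x // x ≠ u} := fun x => if hx : x = u then ⟨v, huv.symm⟩ else ⟨x, hx⟩
  have fu : f u = ⟨v, huv.symm⟩ := dif_pos rfl
  have fx : ∀ x (hx : x ≠ u), f x = ⟨x, hx⟩ := fun x hx => dif_neg hx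
  refine ⟨u, v, f, huv, fun x => ⟨x, fx x x.2⟩, fun x y => ?_, fun x y hxu hxv hyu hyv => ?_,
    fun x hxu hxv => ?_⟩
  · by_cases hx : x = u <;> by_cases hy : y = u
    · subst hx hy; simp
    · subst hx
      rw [fu, fx y hy, Subtype.mk.injEq]
      constructor
      · rintro rfl; simp
      · rintro (rfl | ⟨_, rfl | rfl⟩) <;> simp_all
    · subst hy
      rw [fu, fx x hx, Subtype.mk.injEq]
      constructor
      · rintro rfl; simp
      · rintro (rfl | ⟨rfl | rfl, _⟩) <;> simp_all
    · rw [fx x hx, fx y hy, Subtype.mk.injEq]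
      constructor
      · rintro rfl; simp
      · rintro (rfl | ⟨rfl | rfl, rfl | rfl⟩) <;> simp_all
  · rw [fx x hxu, fx y hyu, h'.black, h'.red, h.black, h.red,
      contractRed_adj (hne hxv) (hne hyv)]
    exact ⟨Iff.rfl, Iff.rfl⟩
  · rw [fu, fx x hxu, h'.black, h'.red]
    exact ⟨h.black_contract_iff hxv, h.red_contract_iff hxv⟩

/-- Every contraction, into a vertex with a larger number, is of this form. -/
lemma exists_of_isContraction (h : Represents G R ρ T) {V' : Type} {T' : Trigraph V'}
    (hc : T.IsContraction T') : ∃ (i j : Fin n) (ρ' : V' → Fin n), i ∈ Set.range ρ ∧ i < j ∧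
      j ∈ Set.range ρ' ∧ Set.range ρ' = Set.range ρ \ {i} ∧
      Represents G (contractRed G R i j) ρ' T' := by
  -- A contraction is symmetric in its two vertices, so the one with the larger index can be called
  -- `v`, and the merged vertex can be addressed as `f v`.
  have main : ∃ (u v : V) (f : V → V'), ρ u < ρ v ∧ Function.Surjective f ∧
    (∀ x y, f x = f y ↔ x = y ∨ ((x = u ∨ x = v) ∧ (y = u ∨ y = v))) ∧
    (∀ x y, x ≠ u → x ≠ v → y ≠ u → y ≠ v →
      (T'.black.Adj (f x) (f y) ↔ T.black.Adj x y) ∧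
      (T'.red.Adj (f x) (f y) ↔ T.red.Adj x y)) ∧
    (∀ x, x ≠ u → x ≠ v →
      (T'.black.Adj (f v) (f x) ↔ T.black.Adj u x ∧ T.black.Adj v x) ∧
      (T'.red.Adj (f v) (f x) ↔
        x ∈ T.nbrs u ∆ T.nbrs v ∨
        (x ∈ T.nbrs u ∩ T.nbrs v ∧ ¬ (T.black.Adj u x ∧ T.black.Adj v x)))) := by
    obtain ⟨u, v, f, huv, hf, hfib, h1, h2⟩ := hc
    have hfuv : f u = f v := (hfib u v).2 (by simp)
    rcases lt_or_gt_of_ne (h.injective.ne huv) with hlt | hlt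
    · exact ⟨u, v, f, hlt, hf, hfib, h1, by rwa [← hfuv]⟩
    · refine ⟨v, u, f, hlt, hf, fun x y => by rw [hfib]; tauto,
        fun x y a b c d => h1 x y b a d c, fun x hx hx' => ?_⟩
      obtain ⟨e1, e2⟩ := h2 x hx' hx
      rw [e1, e2, symmDiff_comm, Set.inter_comm, and_comm (a := T.black.Adj u x)]
      exact ⟨Iff.rfl, Iff.rfl⟩
  obtain ⟨u, v, f, huv, hf, hfib, h1, h2⟩ := main
  have hvu : v ≠ u := fun e => absurd huv (by rw [e]; exact lt_irrefl _)
  have hfuv : f u = f v := (hfib u v).2 (by simp)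
  -- A section of `f` that avoids `u`: the merged vertex inherits the name of `v`, the others keep
  -- theirs.
  have hg : ∀ y, ∃ x, x ≠ u ∧ f x = y := fun y => by
    obtain ⟨x, rfl⟩ := hf y
    by_cases hx : x = u
    · exact ⟨v, hvu, by rw [hx, hfuv]⟩
    · exact ⟨x, hx, rfl⟩
  choose g hgu hfg using hg
  have hinj : ∀ x x', x ≠ u → x' ≠ u → f x = f x' → x = x' := fun x x' hx hx' e => by
    rcases (hfib x x').1 e with e | ⟨rfl | rfl, rfl | rfl⟩ <;> simp_all
  have hgf : ∀ x, x ≠ u → g (f x) = x := fun x hx => hinj _ _ (hgu _) hx (hfg _)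
  have hne : ∀ {x y : V}, x ≠ y → ρ x ≠ ρ y := fun hxy hρ => hxy (h.injective hρ)
  refine ⟨ρ u, ρ v, ρ ∘ g, ⟨u, rfl⟩, huv, ⟨f v, by simp [hgf v hvu]⟩, ?_, ?_⟩
  · ext z
    constructor
    · rintro ⟨y, rfl⟩
      exact ⟨⟨g y, rfl⟩, hne (hgu y)⟩
    · rintro ⟨⟨x, rfl⟩, hx⟩
      exact ⟨f x, by simp [hgf x (fun e => hx (by rw [e]; rfl))]⟩
  have key : ∀ y y', (T'.red.Adj y y' ↔ (contractRed G R (ρ u) (ρ v)).Adj (ρ (g y)) (ρ (g y'))) ∧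
      (T'.black.Adj y y' ↔ G.Adj (ρ (g y)) (ρ (g y')) ∧
        ¬ (contractRed G R (ρ u) (ρ v)).Adj (ρ (g y)) (ρ (g y'))) := by
    have hv : ∀ x, x ≠ u → x ≠ v → (T'.red.Adj (f v) (f x) ↔
        (contractRed G R (ρ u) (ρ v)).Adj (ρ v) (ρ x)) ∧ (T'.black.Adj (f v) (f x) ↔
        G.Adj (ρ v) (ρ x) ∧ ¬ (contractRed G R (ρ u) (ρ v)).Adj (ρ v) (ρ x)) := by
      intro x hxu hxv
      obtain ⟨e1, e2⟩ := h2 x hxu hxv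
      exact ⟨e2.trans (h.red_contract_iff hxv).symm, e1.trans (h.black_contract_iff hxv).symm⟩
    intro y y'
    obtain ⟨x, hx, rfl⟩ : ∃ x, x ≠ u ∧ f x = y := ⟨g y, hgu y, hfg y⟩
    obtain ⟨x', hx', rfl⟩ : ∃ x, x ≠ u ∧ f x = y' := ⟨g y', hgu y', hfg y'⟩
    rw [hgf x hx, hgf x' hx']
    by_cases hxv : x = v <;> by_cases hxv' : x' = v
    · subst hxv hxv'
      simp
    · subst hxv
      exact hv x' hx' hxv'
    · subst hxv'
      rw [T'.red.adj_comm, T'.black.adj_comm, G.adj_comm, SimpleGraph.adj_comm _ (ρ x)]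
      exact hv x hx hxv
    · obtain ⟨e1, e2⟩ := h1 x x' hx hxv hx' hxv'
      rw [e1, e2, contractRed_adj (hne hxv) (hne hxv'), h.red, h.black]
      exact ⟨Iff.rfl, Iff.rfl⟩
  exact ⟨fun y y' e => by rw [← hfg y, ← hfg y', h.injective e], fun y y' => (key y y').1,
    fun y y' => (key y y').2⟩

end Represents

/-! ### First and last elements of a finite order. -/

section order

variable {α : Type} [Finite α] {S : Set α} {lt : α → α → Prop}

/-- A minimal element of a finite strict order, by totality. Nothing is assumed about `lt` on the
diagonal, where the order literals carry no meaning, so the diagonal is removed first. -/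
lemma exists_first (hS : S.Nonempty)
    (trans : ∀ i ∈ S, ∀ j ∈ S, ∀ k ∈ S, i ≠ k → lt i j → lt j k → lt i k)
    (total : ∀ i ∈ S, ∀ j ∈ S, i ≠ j → (lt j i ↔ ¬ lt i j)) :
    ∃ i ∈ S, ∀ j ∈ S, i ≠ j → lt i j := by
  let r : S → S → Prop := fun x y => x ≠ y ∧ lt x y
  have : IsTrans S r := ⟨fun x y z ⟨h1, h2⟩ ⟨h3, h4⟩ => by
    have hxz : x ≠ z := by
      rintro rfl
      exact (total _ x.2 _ y.2 (fun e => h1 (Subtype.ext e))).1 h4 h2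
    exact ⟨hxz, trans _ x.2 _ y.2 _ z.2 (fun e => hxz (Subtype.ext e)) h2 h4⟩⟩
  have : Std.Irrefl r := ⟨fun x h => h.1 rfl⟩
  have wf : WellFounded r := Finite.wellFounded_of_trans_of_irrefl r
  obtain ⟨x, hx⟩ := hS
  obtain ⟨m, -, hm⟩ := wf.has_min Set.univ ⟨⟨x, hx⟩, trivial⟩
  refine ⟨m, m.2, fun j hj hmj => ?_⟩
  by_contra hlt
  exact hm ⟨j, hj⟩ trivial ⟨fun e => hmj (by rw [← e]), (total _ m.2 _ hj hmj).2 hlt⟩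

lemma exists_last (hS : S.Nonempty)
    (trans : ∀ i ∈ S, ∀ j ∈ S, ∀ k ∈ S, i ≠ k → lt i j → lt j k → lt i k)
    (total : ∀ i ∈ S, ∀ j ∈ S, i ≠ j → (lt j i ↔ ¬ lt i j)) :
    ∃ i ∈ S, ∀ j ∈ S, i ≠ j → lt j i :=
  exists_first (lt := flip lt) hS
    (fun i hi j hj k hk hik h1 h2 => trans k hk j hj i hi hik.symm h2 h1)
    fun i hi j hj hij => total j hj i hi hij.symm

end order

/-! ### From schemes to sequences, and extension of schemes by a vertex. -/

namespace IsScheme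

variable {n : ℕ} {G R : SimpleGraph (Fin n)} {d : ℕ} {S : Set (Fin n)} {lt p : Fin n → Fin n → Prop}
  {red : Fin n → Fin n → Fin n → Prop} {a : Fin n → Fin n → Prop}

/-- The first vertex of the ordering can be removed. -/
lemma erase (h : IsScheme G d S lt p red a) {i : Fin n} (hi : i ∈ S)
    (hfirst : ∀ j ∈ S, i ≠ j → lt i j) : IsScheme G d (S \ {i}) lt p red a where
  trans := fun i hi j hj k hk => h.trans i hi.1 j hj.1 k hk.1
  total := fun i hi j hj => h.total i hi.1 j hj.1
  parent := fun x hx ⟨k, hk, hxk⟩ => by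
    obtain ⟨j, hj, hxj, hp⟩ := h.parent x hx.1 ⟨k, hk.1, hxk⟩
    refine ⟨j, ⟨hj, ?_⟩, hxj, hp⟩
    -- A parent comes later than its child, so the first vertex is nobody's parent and its removal
    -- leaves all parents in place.
    rintro rfl
    exact (h.total _ hj _ hx.1 hxj.ne').1 (h.parent_later x hx.1 _ hj hxj hp) (hfirst x hx.1 hxj.ne')
  parent_unique := fun i hi j hj k hk => h.parent_unique i hi.1 j hj.1 k hk.1
  parent_later := fun i hi j hj => h.parent_later i hi.1 j hj.1
  red_symm := h.red_symm
  a_symm := h.a_symm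
  auxiliary := fun i hi j hj k hk => h.auxiliary i hi.1 j hj.1 k hk.1
  create := fun i hi j hj k hk => h.create i hi.1 j hj.1 k hk.1
  transfer := fun i hi j hj k hk => h.transfer i hi.1 j hj.1 k hk.1
  keep := fun i hi j hj k hk m hm => h.keep i hi.1 j hj.1 k hk.1 m hm.1
  degree := fun i hi j hj => h.degree i hi.1 j hj.1

/-- The first vertex has a parent, unless it is the only one. -/
lemma exists_parent (h : IsScheme G d S lt p red a) {i k : Fin n} (hi : i ∈ S)
    (hfirst : ∀ j ∈ S, i ≠ j → lt i j) (hk : k ∈ S) (hik : i ≠ k) : ∃ j ∈ S, i < j ∧ p i j := by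
  obtain ⟨z, hz, hlast⟩ := exists_last ⟨i, hi⟩ h.trans h.total
  have hiz : i ≠ z := by
    rintro rfl
    exact (h.total _ hi _ hk hik).1 (hlast k hk hik) (hfirst k hk hik)
  -- The last vertex `z` of the order has the largest index in `S`, since otherwise it would have a
  -- parent, which comes later. Hence `i < z`, and `i` must have a parent.
  refine h.parent i hi ⟨z, hz, lt_of_not_ge fun hle => ?_⟩
  obtain ⟨y, hy, hzy, hp⟩ := h.parent z hz ⟨i, hi, lt_of_le_of_ne hle hiz.symm⟩
  exact (h.total _ hz _ hy hzy.ne).1 (hlast y hy hzy.ne) (h.parent_later z hz y hy hzy hp)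

/-- Induction on the number of survivors, contracting the first vertex into its parent. Two
invariants control the current red graph `R`: its edges are recorded in `a`, so that they can be
transferred to a parent, and those avoiding the vertex that is eliminated next already lie in its
`red`. The new red graph then lies in `red` as well, and the degree condition makes the next
trigraph admissible. -/
lemma hasDSequence_aux (m : ℕ) : ∀ {V : Type} {S : Set (Fin n)} {R : SimpleGraph (Fin n)}
    {ρ : V → Fin n} {T : Trigraph V}, S.ncard = m + 1 → Set.range ρ = S →
    IsScheme G d S lt p red a → Represents G R ρ T →
    (∀ j ∈ S, ∀ k ∈ S, R.Adj j k → a j k) →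
    (∀ i ∈ S, (∀ j ∈ S, i ≠ j → lt i j) → ∀ j ∈ S, ∀ k ∈ S, i ≠ j → i ≠ k → R.Adj j k → red i j k) →
    Trigraph.IsDTrigraph d T → Trigraph.HasDSequence d T := by
  induction m with
  | zero =>
    intro V S R ρ T hS hρ _ hT _ _ hd
    refine .single T ?_ hd
    have e : S.ncard = Nat.card V := by
      rw [← hρ, ← Set.image_univ, Set.ncard_image_of_injective _ hT.injective, Set.ncard_univ]
    rw [← e, hS]
  | succ m ih =>
    intro V S R ρ T hS hρ h hT ha hr hd
    obtain ⟨i, hi, hfirst⟩ := exists_first (Set.nonempty_of_ncard_ne_zero (by omega)) h.trans h.total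
    obtain ⟨k, hk, hki⟩ := Set.exists_ne_of_one_lt_ncard (by omega : 1 < S.ncard) i
    obtain ⟨j, hj, hij, hp⟩ := h.exists_parent hi hfirst hk hki.symm
    obtain ⟨u, rfl⟩ : i ∈ Set.range ρ := hρ ▸ hi
    obtain ⟨v, rfl⟩ : j ∈ Set.range ρ := hρ ▸ hj
    have huv : u ≠ v := fun e => by rw [e] at hij; exact lt_irrefl _ hij
    set R' := contractRed G R (ρ u) (ρ v) with hR'
    have hT' : Represents G R' (fun x : {x // x ≠ u} => ρ x.1) (Represents.trigraph G R' _) :=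
      Represents.trigraph_represents fun x y e => Subtype.ext (hT.injective e)
    have hcontr := hT.isContraction huv hT'
    have hnew : ∀ y ∈ S, y ≠ ρ u → y ≠ ρ v → (R.Adj (ρ u) y ∨ ¬ (G.Adj (ρ u) y ↔ G.Adj (ρ v) y)) →
        red (ρ u) (ρ v) y := by
      rintro y hy hyu hyv (hy' | hy')
      · exact h.transfer _ hi _ hj y hy hyu.symm hyv.symm hij hp (hfirst y hy hyu.symm)
          (ha _ hi _ hy hy')
      · exact h.create _ hi _ hj y hy hij hyu hyv hy' hp (hfirst y hy hyu.symm)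
    have hred : ∀ y ∈ S, ∀ z ∈ S, y ≠ ρ u → z ≠ ρ u → R'.Adj y z → red (ρ u) y z := by
      rintro y hy z hz hyu hzu ⟨hyz, hR | ⟨rfl, hR⟩ | ⟨rfl, hR⟩⟩
      · exact hr _ hi hfirst y hy z hz hyu.symm hzu.symm hR
      · exact hnew z hz hzu hyz.symm hR
      · exact h.red_symm _ _ _ (hnew y hy hyu hyz hR)
    refine .contract T _ hd hcontr (ih (S := S \ {ρ u}) (R := R') ?_ ?_ (h.erase hi hfirst) hT'
      ?_ ?_ ?_)
    · rw [Set.ncard_sdiff_singleton_of_mem hi, hS]; rfl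
    · ext z
      constructor
      · rintro ⟨⟨x, hx⟩, rfl⟩
        exact ⟨hρ ▸ ⟨x, rfl⟩, fun e => hx (hT.injective e)⟩
      · rintro ⟨hz, hzu⟩
        rw [← hρ] at hz
        obtain ⟨x, rfl⟩ := hz
        exact ⟨⟨x, fun e => hzu (by rw [e]; rfl)⟩, rfl⟩
    · rintro y ⟨hy, hyu⟩ z ⟨hz, hzu⟩ hyz
      -- The condition `auxiliary` is available only if the eliminated vertex has a smaller index
      -- than an endpoint. If it is smaller than neither, then neither endpoint is the parent, so
      -- the edge was red before and is recorded already.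
      by_cases hlt : ρ u < y
      · exact h.auxiliary _ hi y hy z hz (Ne.symm hyu) (Ne.symm hzu) hyz.ne hlt
          (hfirst y hy (Ne.symm hyu)) (hfirst z hz (Ne.symm hzu)) (hred y hy z hz hyu hzu hyz)
      · by_cases hlt' : ρ u < z
        · exact h.a_symm _ _ <| h.auxiliary _ hi z hz y hy (Ne.symm hzu) (Ne.symm hyu) hyz.ne.symm
            hlt' (hfirst z hz (Ne.symm hzu)) (hfirst y hy (Ne.symm hyu))
            (hred z hz y hy hzu hyu hyz.symm)
        · rcases hyz.2 with hR | ⟨rfl, -⟩ | ⟨rfl, -⟩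
          · exact ha y hy z hz hR
          · exact absurd hij hlt
          · exact absurd hij hlt'
    · rintro x ⟨hx, hxu⟩ hxf y ⟨hy, hyu⟩ z ⟨hz, hzu⟩ hxy hxz hyz
      -- The vertex `x` is eliminated right after `ρ u`; the red edges that avoid it pass from the
      -- one stage to the other.
      exact h.keep _ hi x hx y hy z hz (Ne.symm hxu) (Ne.symm hyu) (Ne.symm hzu) hxy hxz hyz.ne
        (hfirst x hx (Ne.symm hxu)) (hxf y ⟨hy, hyu⟩ hxy) (hxf z ⟨hz, hzu⟩ hxz)
        (hred y hy z hz hyu hzu hyz)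
    · rintro ⟨x, hx⟩
      have hxu : ρ x ≠ ρ u := hT.injective.ne hx
      have hxS : ∀ x, ρ x ∈ S := fun x => hρ ▸ ⟨x, rfl⟩
      have hinj : Function.Injective fun y : {x // x ≠ u} => ρ y.1 :=
        fun x y e => Subtype.ext (hT.injective e)
      refine le_trans ?_ (Nat.cast_le.2 (h.degree _ hi _ (hxS x) hxu.symm))
      rw [(Set.toFinite _).cast_ncard_eq, ← hinj.encard_image]
      refine Set.encard_le_encard ?_
      rintro _ ⟨⟨y, hy⟩, hxy, rfl⟩
      have hadj : R'.Adj (ρ x) (ρ y) := (hT'.red ⟨x, hx⟩ ⟨y, hy⟩).1 hxy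
      exact ⟨hadj.ne', hred _ (hxS x) _ (hxS y) hxu (hT.injective.ne hy) hadj⟩

lemma hasDSequence (hn : 1 ≤ n) (h : IsScheme G d Set.univ lt p red a) :
    Trigraph.HasDSequence d (Trigraph.ofGraph G) := by
  refine hasDSequence_aux (R := ⊥) (ρ := id) (n - 1) ?_ Set.range_id h ⟨fun _ _ => id, ?_, ?_⟩
    ?_ ?_ ?_
  · rw [Set.ncard_univ, Nat.card_fin]; omega
  all_goals simp [Trigraph.ofGraph, Trigraph.IsDTrigraph]

/-- A vertex can be added in front of the ordering. -/
lemma insert {S' : Set (Fin n)} {lt' p' : Fin n → Fin n → Prop}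
    {red' : Fin n → Fin n → Fin n → Prop} {a' : Fin n → Fin n → Prop} {i j : Fin n}
    (hi : i ∈ S) (hS : S' = S \ {i}) (hj : j ∈ S') (hij : i < j)
    (h : IsScheme G d S' lt' p' red' a')
    (hsupp : ∀ x y z, red' x y z → x ∈ S' ∧ y ∈ S' ∧ z ∈ S')
    (ha : ∀ y ∈ S', ∀ z ∈ S', (contractRed G R i j).Adj y z → a' y z)
    (hr : ∀ x ∈ S', ∀ y ∈ S', ∀ z ∈ S', lt' x y → lt' x z → x ≠ y → x ≠ z →
      (contractRed G R i j).Adj y z → red' x y z)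
    (hd : ∀ y ∈ S', {z | z ∈ S' ∧ (contractRed G R i j).Adj y z}.ncard ≤ d) :
    ∃ (lt p : Fin n → Fin n → Prop) (red : Fin n → Fin n → Fin n → Prop) (a : Fin n → Fin n → Prop),
      IsScheme G d S lt p red a ∧ (∀ x y z, red x y z → x ∈ S ∧ y ∈ S ∧ z ∈ S) ∧
      (∀ y ∈ S, ∀ z ∈ S, R.Adj y z → a y z) ∧
      (∀ x ∈ S, ∀ y ∈ S, ∀ z ∈ S, lt x y → lt x z → x ≠ y → x ≠ z → R.Adj y z → red x y z) := by
  have mem : ∀ {x}, x ∈ S → x ≠ i → x ∈ S' := fun hx hxi => by rw [hS]; exact ⟨hx, hxi⟩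
  have sub : ∀ {x}, x ∈ S' → x ∈ S := fun hx => by rw [hS] at hx; exact hx.1
  have ne : ∀ {x}, x ∈ S' → x ≠ i := fun hx => by rw [hS] at hx; exact hx.2
  -- The new first vertex `i` gets the parent `j`, its `red` is the contracted red graph on the
  -- survivors, and `a` at `i` is read off from `R`. All else is inherited.
  refine ⟨fun x y => y ≠ i ∧ (x = i ∨ lt' x y), fun x y => (x = i ∧ y = j) ∨ (x ≠ i ∧ y ≠ i ∧ p' x y),
    fun x y z => (x = i ∧ y ∈ S' ∧ z ∈ S' ∧ (contractRed G R i j).Adj y z) ∨ (x ≠ i ∧ red' x y z),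
    fun x y => ((x = i ∨ y = i) ∧ R.Adj x y) ∨ (x ≠ i ∧ y ≠ i ∧ a' x y), ?_, ?_, ?_, ?_⟩
  · constructor
    · rintro x hx y hy z hz hxz ⟨hyi, hxy⟩ ⟨hzi, hyz⟩
      refine ⟨hzi, ?_⟩
      by_cases hxi : x = i
      · exact Or.inl hxi
      · exact Or.inr (h.trans x (mem hx hxi) y (mem hy hyi) z (mem hz hzi) hxz (hxy.resolve_left hxi)
          (hyz.resolve_left hyi))
    · intro x hx y hy hxy
      by_cases hxi : x = i
      · subst hxi; simp [hxy.symm]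
      · by_cases hyi : y = i
        · subst hyi; simp [hxy]
        · simp [hxi, hyi, h.total x (mem hx hxi) y (mem hy hyi) hxy]
    · rintro x hx ⟨k, hk, hxk⟩
      by_cases hxi : x = i
      · exact ⟨j, sub hj, hxi ▸ hij, Or.inl ⟨hxi, rfl⟩⟩
      -- If the only known vertex with larger index is `i`, its parent `j` has a still larger index
      -- and is not removed.
      · obtain ⟨y, hy, hxy, hp⟩ := h.parent x (mem hx hxi) (by
          by_cases hki : k = i
          · exact ⟨j, hj, hxk.trans (hki ▸ hij)⟩
          · exact ⟨k, mem hk hki, hxk⟩)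
        exact ⟨y, sub hy, hxy, Or.inr ⟨hxi, ne hy, hp⟩⟩
    · rintro x hx y hy z hz hxy hxz (⟨h1, rfl⟩ | ⟨h1, hyi, hp⟩) (⟨h1', rfl⟩ | ⟨h1', hzi, hp'⟩)
      · rfl
      · exact absurd h1 h1'
      · exact absurd h1' h1
      · exact h.parent_unique x (mem hx h1) y (mem hy hyi) z (mem hz hzi) hxy hxz hp hp'
    · rintro x hx y hy hxy (⟨h1, rfl⟩ | ⟨h1, hyi, hp⟩)
      · exact ⟨ne hj, Or.inl h1⟩
      · exact ⟨hyi, Or.inr (h.parent_later x (mem hx h1) y (mem hy hyi) hxy hp)⟩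
    · rintro x y z (⟨h1, hy, hz, h2⟩ | ⟨h1, h2⟩)
      · exact Or.inl ⟨h1, hz, hy, h2.symm⟩
      · exact Or.inr ⟨h1, h.red_symm _ _ _ h2⟩
    · rintro x y (⟨h1, h2⟩ | ⟨h1, h2, h3⟩)
      · exact Or.inl ⟨h1.symm, h2.symm⟩
      · exact Or.inr ⟨h2, h1, h.a_symm _ _ h3⟩
    · rintro x hx y hy z hz hxy hxz hyz hlt ⟨hyi, hl1⟩ ⟨hzi, hl2⟩ (⟨h1, _, _, h2⟩ | ⟨h1, h2⟩)
      · exact Or.inr ⟨hyi, hzi, ha y (mem hy hyi) z (mem hz hzi) h2⟩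
      · exact Or.inr ⟨hyi, hzi, h.auxiliary x (mem hx h1) y (mem hy hyi) z (mem hz hzi) hxy hxz hyz
          hlt (hl1.resolve_left h1) (hl2.resolve_left h1) h2⟩
    · rintro x hx y hy z hz hxy hzx hzy hG (⟨rfl, rfl⟩ | ⟨h1, hyi, hp⟩) ⟨hzi, hl⟩
      · exact Or.inl ⟨rfl, hj, mem hz hzi, (contractRed_adj_left hzy).2 (Or.inr (Or.inr hG))⟩
      · exact Or.inr ⟨h1, h.create x (mem hx h1) y (mem hy hyi) z (mem hz hzi) hxy hzx hzy hG hp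
          (hl.resolve_left h1)⟩
    · rintro x hx y hy z hz hxz hyz hxy (⟨rfl, rfl⟩ | ⟨h1, hyi, hp⟩) ⟨hzi, hl⟩
        (⟨_, h2⟩ | ⟨h2, h3, h4⟩)
      · exact Or.inl ⟨rfl, hj, mem hz hzi, (contractRed_adj_left hyz.symm).2 (Or.inr (Or.inl h2))⟩
      · exact absurd rfl h2
      · rename_i h3
        exact absurd (h3.resolve_left h1) hzi
      · exact Or.inr ⟨h1, h.transfer x (mem hx h1) y (mem hy hyi) z (mem hz hzi) hxz hyz hxy hp
          (hl.resolve_left h1) h4⟩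
    -- When the earlier vertex is `i`, its red edges are those of the contracted graph, and `hr`
    -- says that they persist until both ends or one of them are reached by the order.
    · rintro x hx y hy z hz w hw hxy hxz hxw hyz hyw hzw ⟨hyi, l1⟩ ⟨hzi, l2⟩ ⟨hwi, l3⟩
        (⟨rfl, hz', hw', h2⟩ | ⟨h1, h2⟩)
      · exact Or.inr ⟨hyi, hr y (mem hy hyi) z hz' w hw' (l2.resolve_left hyi) (l3.resolve_left hyi)
          hyz hyw h2⟩
      · exact Or.inr ⟨hyi, h.keep x (mem hx h1) y (mem hy hyi) z (mem hz hzi) w (mem hw hwi) hxy hxz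
          hxw hyz hyw hzw (l1.resolve_left h1) (l2.resolve_left hyi) (l3.resolve_left hyi) h2⟩
    · intro x hx y hy hxy
      by_cases hxi : x = i
      · by_cases hy' : y ∈ S'
        · refine (Set.ncard_le_ncard ?_ (Set.toFinite _)).trans (hd y hy')
          rintro z ⟨_, ⟨_, _, hz, h2⟩ | ⟨h1, _⟩⟩
          · exact ⟨hz, h2⟩
          · exact absurd hxi h1
        · exact absurd (mem hy fun e => hxy (hxi.trans e.symm)) hy'
      · by_cases hy' : y ∈ S'
        · refine (Set.ncard_le_ncard ?_ (Set.toFinite _)).trans (h.degree x (mem hx hxi) y hy' hxy)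
          rintro z ⟨hzy, ⟨h1, _⟩ | ⟨_, h2⟩⟩
          · exact absurd h1 hxi
          · exact ⟨hzy, h2⟩
        -- Here `y` is the vertex `i`, eliminated before `x`. It has no red edges at that stage
        -- because `red'` is supported on `S'`; this is why the support is part of the induction.
        · convert Nat.zero_le d
          rw [Set.ncard_eq_zero, Set.eq_empty_iff_forall_notMem]
          rintro z ⟨_, ⟨_, h1, _⟩ | ⟨_, h2⟩⟩
          · exact hy' h1
          · exact hy' (hsupp _ _ _ h2).2.1
  · rintro x y z (⟨rfl, hy, hz, _⟩ | ⟨_, h1⟩)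
    · exact ⟨hi, sub hy, sub hz⟩
    · obtain ⟨hx, hy, hz⟩ := hsupp _ _ _ h1
      exact ⟨sub hx, sub hy, sub hz⟩
  · intro y hy z hz hyz
    by_cases hi' : y = i ∨ z = i
    · exact Or.inl ⟨hi', hyz⟩
    · rw [not_or] at hi'
      exact Or.inr ⟨hi'.1, hi'.2, ha y (mem hy hi'.1) z (mem hz hi'.2) (le_contractRed hyz)⟩
  · rintro x hx y hy z hz ⟨hyi, l1⟩ ⟨hzi, l2⟩ hxy hxz hyz
    by_cases hxi : x = i
    · exact Or.inl ⟨hxi, mem hy hyi, mem hz hzi, le_contractRed hyz⟩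
    · exact Or.inr ⟨hxi, hr x (mem hx hxi) y (mem hy hyi) z (mem hz hzi) (l1.resolve_left hxi)
        (l2.resolve_left hxi) hxy hxz (le_contractRed hyz)⟩

end IsScheme

/-! ### From sequences to schemes. -/

namespace Trigraph.HasDSequence

variable {d : ℕ} {V : Type} {T : Trigraph V}

lemma isDTrigraph (h : HasDSequence d T) : IsDTrigraph d T := by
  cases h <;> assumption

lemma mono {d' : ℕ} (h : HasDSequence d T) (hd : d ≤ d') : HasDSequence d' T := by
  have hm : ∀ {V : Type} {T : Trigraph V}, IsDTrigraph d T → IsDTrigraph d' T :=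
    fun h v => (h v).trans (Nat.cast_le.2 hd)
  induction h with
  | single T h h' => exact .single T h (hm h')
  | contract T T' h h' _ ih => exact .contract T T' (hm h) h' ih

/-- Induction from the one-vertex end of the sequence. The statement is strengthened by the support
of `red` and by the facts that `a` and `red` contain the present red edges, which are what
`IsScheme.insert` needs in the next step. -/
lemma exists_scheme (h : HasDSequence d T) {n : ℕ} (G : SimpleGraph (Fin n)) :
    ∀ {R : SimpleGraph (Fin n)} {ρ : V → Fin n}, Represents G R ρ T →
    ∃ (lt p : Fin n → Fin n → Prop) (red : Fin n → Fin n → Fin n → Prop) (a : Fin n → Fin n → Prop),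
      IsScheme G d (Set.range ρ) lt p red a ∧
      (∀ x y z, red x y z → x ∈ Set.range ρ ∧ y ∈ Set.range ρ ∧ z ∈ Set.range ρ) ∧
      (∀ y ∈ Set.range ρ, ∀ z ∈ Set.range ρ, R.Adj y z → a y z) ∧
      (∀ x ∈ Set.range ρ, ∀ y ∈ Set.range ρ, ∀ z ∈ Set.range ρ, lt x y → lt x z → x ≠ y → x ≠ z →
        R.Adj y z → red x y z) := by
  induction h with
  | @single V T hV _ =>
    intro R ρ hT
    have hsub : ∀ x ∈ Set.range ρ, ∀ y ∈ Set.range ρ, x = y := by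
      have := (Nat.card_eq_one_iff_unique.1 hV).1
      rintro _ ⟨x, rfl⟩ _ ⟨y, rfl⟩
      rw [Subsingleton.elim x y]
    refine ⟨fun _ _ => False, fun _ _ => False, fun _ _ _ => False, fun _ _ => False,
      ⟨by simp, ?_, ?_, by simp, by simp, by simp, by simp, by simp, by simp, by simp, by simp,
        by simp⟩, by simp, ?_, by simp⟩
    · exact fun i hi j hj hij => absurd (hsub i hi j hj) hij
    · exact fun i hi ⟨k, hk, hik⟩ => absurd (hsub i hi k hk) hik.ne
    · exact fun i hi j hj hij => absurd (hsub i hi j hj) hij.ne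
  | @contract V V' T T' _ hc hT'd ih =>
    intro R ρ hT
    obtain ⟨i, j, ρ', hi, hij, hj, hS, hT'⟩ := hT.exists_of_isContraction hc
    obtain ⟨lt, p, red, a, h, hsupp, ha, hr⟩ := ih hT'
    refine h.insert hi hS hj hij hsupp ha hr ?_
    rintro _ ⟨y, rfl⟩
    have := hT'd.isDTrigraph y
    rw [← hT'.injective.encard_image] at this
    rw [← Nat.cast_le (α := ℕ∞), (Set.toFinite _).cast_ncard_eq]
    refine le_trans (Set.encard_le_encard ?_) this
    rintro _ ⟨⟨z, rfl⟩, hyz⟩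
    exact ⟨z, (hT'.red _ _).2 hyz, rfl⟩

end Trigraph.HasDSequence

open Trigraph in
lemma hasDSequence_iff_exists_scheme {n : ℕ} (hn : 1 ≤ n) (G : SimpleGraph (Fin n)) (d : ℕ) :
    HasDSequence d (ofGraph G) ↔ ∃ lt p red a, IsScheme G d Set.univ lt p red a := by
  constructor
  · intro h
    obtain ⟨lt, p, red, a, h, -⟩ := h.exists_scheme G (R := ⊥) (ρ := id)
      ⟨Function.injective_id, by simp [ofGraph], by simp [ofGraph]⟩
    rw [Set.range_id] at h
    exact ⟨lt, p, red, a, h⟩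
  · rintro ⟨lt, p, red, a, h⟩
    exact h.hasDSequence hn

open Trigraph in
lemma twinWidth_le_iff {n : ℕ} (hn : 1 ≤ n) (G : SimpleGraph (Fin n)) (d : ℕ) :
    twinWidth G ≤ d ↔ HasDSequence d (ofGraph G) := by
  have hne : {d | HasDSequence d (ofGraph G)}.Nonempty := by
    -- Some width must be attained, because the infimum of the empty set would be `0`. For width
    -- `n`, take the order of the indices, the last vertex as everybody's parent, and declare all
    -- edges red.
    refine ⟨n, (hasDSequence_iff_exists_scheme hn G n).2 ⟨fun i j => i < j, fun _ j => j = ⟨n - 1,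
      by omega⟩, fun _ _ _ => True, fun _ _ => True, ?_⟩⟩
    refine ⟨fun i _ j _ k _ _ => lt_trans, fun i _ j _ hij => ?_, fun i _ ⟨k, _, hik⟩ =>
      ⟨⟨n - 1, by omega⟩, trivial, ?_, rfl⟩, fun _ _ _ _ _ _ _ _ h1 h2 => h1.trans h2.symm,
      fun _ _ _ _ h _ => h, by simp, by simp, by simp, by simp, by simp, by simp, fun i _ j _ _ =>
      (Set.ncard_le_card _).trans (by simp)⟩
    · rw [not_lt]
      exact ⟨le_of_lt, fun h => lt_of_le_of_ne h hij.symm⟩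
    · rw [Fin.lt_def] at hik ⊢
      have := k.2
      show (i : ℕ) < n - 1
      omega
  exact ⟨fun h => (Nat.sInf_mem hne : HasDSequence _ _).mono h, fun h => Nat.sInf_le h⟩

/-! ## Assignments and schemes -/

namespace RelEncoding

open Literal

variable {n : ℕ} {τ : RelVar → Bool}

lemma oStar_comm {i j : ℕ} (hij : i ≠ j) : (oStar j i).Holds τ ↔ ¬ (oStar i j).Holds τ := by
  rcases lt_or_gt_of_ne hij with h | h
  · simp [oStar, h, not_lt.2 h.le, Holds]
  · simp [oStar, h, not_lt.2 h.le, Holds]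

lemma aStar_comm (i j : ℕ) : aStar i j = aStar j i := by
  rcases lt_trichotomy i j with h | rfl | h
  · simp [aStar, h, not_lt.2 h.le]
  · rfl
  · simp [aStar, h, not_lt.2 h.le]

lemma rStar_comm (i j k : ℕ) : rStar i j k = rStar i k j := by
  rcases lt_trichotomy j k with h | rfl | h
  · simp [rStar, h, not_lt.2 h.le]
  · rfl
  · simp [rStar, h, not_lt.2 h.le]

/-- The inputs of a totalizer are the literals `r*ᵢⱼₖ` with `k ≠ j`. -/
lemma count_cardInput (i : ℕ) (j : Fin n) : Totalizer.count (cardInput i j) τ 0 (n - 1) =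
    {k : Fin n | k ≠ j ∧ (rStar i j k).Holds τ}.ncard := by
  classical
  rw [Totalizer.count, Set.ncard_eq_toFinset_card', eq_comm]
  have hj := j.2
  refine Finset.card_bij (fun k _ => if (k : ℕ) < j then (k : ℕ) else k - 1) ?_ ?_ ?_
  · intro k hk
    simp only [Set.mem_toFinset, Set.mem_ofPred_eq] at hk
    have hkj : (k : ℕ) ≠ j := fun e => hk.1 (Fin.ext e)
    have := k.2
    simp only [Finset.mem_filter, Finset.mem_range, zero_add, cardInput]
    by_cases h : (k : ℕ) < j
    · simp only [h, if_true]
      exact ⟨by omega, hk.2⟩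
    · have h' : ¬ (k : ℕ) - 1 < j := by omega
      simp only [h, h', if_false]
      rw [Nat.sub_add_cancel (by omega)]
      exact ⟨by omega, hk.2⟩
  · intro k hk l hl e
    simp only [Set.mem_toFinset, Set.mem_ofPred_eq] at hk hl
    have hkj : (k : ℕ) ≠ j := fun e => hk.1 (Fin.ext e)
    have hlj : (l : ℕ) ≠ j := fun e => hl.1 (Fin.ext e)
    apply Fin.ext
    split_ifs at e <;> omega
  · intro q hq
    simp only [Finset.mem_filter, Finset.mem_range, zero_add, cardInput] at hq
    refine ⟨⟨if q < j then q else q + 1, by split_ifs <;> omega⟩, ?_, ?_⟩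
    · simp only [Set.mem_toFinset, Set.mem_ofPred_eq]
      refine ⟨fun e => ?_, hq.2⟩
      have := congrArg Fin.val e
      simp only at this
      split_ifs at this <;> omega
    · simp only
      split_ifs <;> omega

lemma isScheme_of_satisfied {G : SimpleGraph (Fin n)} {d : ℕ}
    (hτ : ∀ C ∈ relEncoding G d, ∃ l ∈ C, l.Holds τ) :
    IsScheme G d Set.univ (fun i j => (oStar i j).Holds τ) (fun i j => (pLit i j).Holds τ)
      (fun i j k => (rStar i j k).Holds τ) (fun i j => (aStar i j).Holds τ) where
  trans := fun i _ j _ k _ hik h1 h2 => by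
    -- The clauses speak of distinct indices; the degenerate cases are trivial.
    by_cases hij : i = j
    · rwa [hij]
    by_cases hjk : j = k
    · rwa [← hjk]
    have := hτ {(oStar i j).neg, (oStar j k).neg, oStar i k} (by
      simp only [relEncoding, Set.mem_union]
      exact .inl <| .inl <| .inl <| .inl <| .inl <| .inl <| .inl <| .inl ⟨i, j, k, hij, hik, hjk, rfl⟩)
    simpa [neg_holds, h1, h2] using this
  total := fun i _ j _ hij => oStar_comm fun e => hij (Fin.ext e)
  parent := fun i _ ⟨k, _, hik⟩ => by
    obtain ⟨_, ⟨j, hij, rfl⟩, h⟩ := hτ {l | ∃ j : Fin n, i < j ∧ l = pLit i j} (by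
      simp only [relEncoding, Set.mem_union]
      refine .inl <| .inl <| .inl <| .inl <| .inl <| .inl <| .inl <| .inr ⟨i, ?_, rfl⟩
      have := k.2
      rw [Fin.lt_def] at hik
      omega)
    exact ⟨j, trivial, hij, h⟩
  parent_unique := fun i _ j _ k _ hij hik h1 h2 => by
    by_contra hjk
    have := hτ {(pLit i j).neg, (pLit i k).neg} (by
      simp only [relEncoding, Set.mem_union]
      exact .inl <| .inl <| .inl <| .inl <| .inl <| .inl <| .inr ⟨i, j, k, hij, hik, hjk, rfl⟩)
    simp [neg_holds, h1, h2] at this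
  parent_later := fun i _ j _ hij h1 => by
    have := hτ {(pLit i j).neg, oStar i j} (by
      simp only [relEncoding, Set.mem_union]
      exact .inl <| .inl <| .inl <| .inl <| .inl <| .inr ⟨i, j, hij, rfl⟩)
    simpa [neg_holds, h1] using this
  red_symm := fun i j k h => by rwa [rStar_comm]
  a_symm := fun i j h => by rwa [aStar_comm]
  auxiliary := fun i _ j _ k _ hij hik hjk hlt h1 h2 h3 => by
    have := hτ {(oStar i j).neg, (oStar i k).neg, (rStar i j k).neg, aStar j k} (by
      simp only [relEncoding, Set.mem_union]
      exact .inl <| .inl <| .inl <| .inl <| .inr ⟨i, j, k, hij, hik, hjk, hlt, rfl⟩)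
    simpa [neg_holds, h1, h2, h3] using this
  create := fun i _ j _ k _ hij hki hkj hG h1 h2 => by
    have := hτ {(pLit i j).neg, (oStar i k).neg, rStar i j k} (by
      simp only [relEncoding, Set.mem_union]
      refine .inl <| .inl <| .inl <| .inr ⟨i, j, k, hij, ?_, rfl⟩
      simp only [Set.mem_sdiff, Set.mem_symmDiff, SimpleGraph.mem_neighborSet, Set.mem_insert_iff,
        Set.mem_singleton_iff]
      tauto)
    simpa [neg_holds, h1, h2] using this
  transfer := fun i _ j _ k _ hik hjk hij h1 h2 h3 => by
    have := hτ {(pLit i j).neg, (oStar i k).neg, (aStar i k).neg, rStar i j k} (by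
      simp only [relEncoding, Set.mem_union]
      exact .inl <| .inl <| .inr ⟨i, j, k, hij.ne, hik, hjk, hij, rfl⟩)
    simpa [neg_holds, h1, h2, h3] using this
  keep := fun i _ j _ k _ m _ hij hik him hjk hjm hkm h1 h2 h3 h4 => by
    rcases lt_or_gt_of_ne hkm with hlt | hlt
    · have := hτ {(oStar i j).neg, (oStar j k).neg, (oStar j m).neg, (rStar i k m).neg, rStar j k m}
        (by
          simp only [relEncoding, Set.mem_union]
          exact .inl <| .inr ⟨i, j, k, m, hij, hik, him, hjk, hjm, hkm, hlt, rfl⟩)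
      simpa [neg_holds, h1, h2, h3, h4] using this
    -- The clause exists for `k < m` only; the other case is the same clause with `k` and `m`
    -- exchanged, by the symmetry of `rStar`.
    · have := hτ {(oStar i j).neg, (oStar j m).neg, (oStar j k).neg, (rStar i m k).neg, rStar j m k}
        (by
          simp only [relEncoding, Set.mem_union]
          exact .inl <| .inr ⟨i, j, m, k, hij, him, hik, hjm, hjk, hkm.symm, hlt, rfl⟩)
      rw [rStar_comm] at h4 ⊢
      simpa [neg_holds, h1, h2, h3, h4] using this
  degree := fun i _ j _ hij => by
    rw [← count_cardInput]
    exact Totalizer.count_le_of_atMost (t := RelVar.t i j) fun C hC => hτ C <| by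
      simp only [relEncoding, Set.mem_union]
      exact .inr ⟨i, j, hij, hC⟩

open Classical in
/-- The values of the main variables given by a scheme. -/
noncomputable def mainAssignment (lt p : Fin n → Fin n → Prop) (red : Fin n → Fin n → Fin n → Prop)
    (a : Fin n → Fin n → Prop) : RelVar → Bool
  | .a i j => decide (∃ (hi : i < n) (hj : j < n), a ⟨i, hi⟩ ⟨j, hj⟩)
  | .o i j => decide (∃ (hi : i < n) (hj : j < n), lt ⟨i, hi⟩ ⟨j, hj⟩)
  | .p i j => decide (∃ (hi : i < n) (hj : j < n), p ⟨i, hi⟩ ⟨j, hj⟩)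
  | .r i j k => decide (∃ (hi : i < n) (hj : j < n) (hk : k < n), red ⟨i, hi⟩ ⟨j, hj⟩ ⟨k, hk⟩)
  | .t _ _ _ _ _ => false

open Classical in
/-- The assignment given by a scheme. -/
noncomputable def assignment (lt p : Fin n → Fin n → Prop) (red : Fin n → Fin n → Fin n → Prop)
    (a : Fin n → Fin n → Prop) : RelVar → Bool
  | .t i j lo len s =>
    decide (s ≤ Totalizer.count (cardInput i j) (mainAssignment lt p red a) lo len)
  | v => mainAssignment lt p red a v

lemma satisfied_of_isScheme {G : SimpleGraph (Fin n)} {d : ℕ} {lt p : Fin n → Fin n → Prop}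
    {red : Fin n → Fin n → Fin n → Prop} {a : Fin n → Fin n → Prop}
    (h : IsScheme G d Set.univ lt p red a) :
    ∀ C ∈ relEncoding G d, ∃ l ∈ C, l.Holds (assignment lt p red a) := by
  set τ := assignment lt p red a with hτ
  have ho : ∀ i j : Fin n, i ≠ j → ((oStar i j).Holds τ ↔ lt i j) := by
    intro i j hij
    by_cases hlt : (i : ℕ) < j
    · simp [oStar, hlt, Holds, hτ, assignment, mainAssignment]
    · simp [oStar, hlt, Holds, hτ, assignment, mainAssignment, h.total i trivial j trivial hij]
  have ha : ∀ i j : Fin n, (aStar i j).Holds τ ↔ a i j := by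
    intro i j
    by_cases hlt : (i : ℕ) < j
    · simp [aStar, hlt, Holds, hτ, assignment, mainAssignment]
    · simpa [aStar, hlt, Holds, hτ, assignment, mainAssignment] using ⟨h.a_symm _ _, h.a_symm _ _⟩
  have hp : ∀ i j : Fin n, (pLit i j).Holds τ ↔ p i j := by
    intro i j
    simp [pLit, Holds, hτ, assignment, mainAssignment]
  have hr : ∀ i j k : Fin n, (rStar i j k).Holds τ ↔ red i j k := by
    intro i j k
    by_cases hlt : (j : ℕ) < k
    · simp [rStar, hlt, Holds, hτ, assignment, mainAssignment]
    · simpa [rStar, hlt, Holds, hτ, assignment, mainAssignment] using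
        ⟨h.red_symm _ _ _, h.red_symm _ _ _⟩
  -- The totalizer inputs are `r` literals, on which both assignments agree. So the auxiliary
  -- variables, defined by counting under the main assignment, also count correctly under `τ`.
  have hc : ∀ i j q, (cardInput i j q).Holds τ ↔
      (cardInput i j q).Holds (mainAssignment lt p red a) := by
    intro i j q
    simp only [cardInput, rStar]
    split_ifs <;> rfl
  have u {x : Fin n} : x ∈ Set.univ := trivial
  rintro C ((((((((⟨i, j, k, hij, hik, hjk, rfl⟩ | ⟨i, hi, rfl⟩) | ⟨i, j, k, hij, hik, hjk, rfl⟩) |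
    ⟨i, j, hij, rfl⟩) | ⟨i, j, k, hij, hik, hjk, hlt, rfl⟩) | ⟨i, j, k, hij, hk, rfl⟩) |
    ⟨i, j, k, hij, hik, hjk, hlt, rfl⟩) |
    ⟨i, j, k, m, hij, hik, him, hjk, hjm, hkm, hlt, rfl⟩) | ⟨i, j, hij, hC⟩)
  · have := h.trans i u j u k u hik
    simp only [Set.mem_insert_iff, Set.mem_singleton_iff, exists_eq_or_imp, exists_eq_left,
      neg_holds, ho _ _ hij, ho _ _ hik, ho _ _ hjk]
    tauto
  · obtain ⟨j, _, hij, hp'⟩ := h.parent i u ⟨⟨i + 1, hi⟩, u, Fin.lt_def.2 (Nat.lt_succ_self _)⟩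
    exact ⟨_, ⟨j, hij, rfl⟩, (hp i j).2 hp'⟩
  · have := h.parent_unique i u j u k u hij hik
    simp only [Set.mem_insert_iff, Set.mem_singleton_iff, exists_eq_or_imp, exists_eq_left,
      neg_holds, hp]
    tauto
  · have := h.parent_later i u j u hij
    simp only [Set.mem_insert_iff, Set.mem_singleton_iff, exists_eq_or_imp, exists_eq_left,
      neg_holds, hp, ho _ _ hij.ne]
    tauto
  · have := h.auxiliary i u j u k u hij hik hjk hlt
    simp only [Set.mem_insert_iff, Set.mem_singleton_iff, exists_eq_or_imp, exists_eq_left,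
      neg_holds, hr, ha, ho _ _ hij, ho _ _ hik]
    tauto
  · simp only [Set.mem_sdiff, Set.mem_symmDiff, SimpleGraph.mem_neighborSet, Set.mem_insert_iff,
      Set.mem_singleton_iff, not_or] at hk
    have := h.create i u j u k u hij hk.2.1 hk.2.2 (by tauto)
    simp only [Set.mem_insert_iff, Set.mem_singleton_iff, exists_eq_or_imp, exists_eq_left,
      neg_holds, hr, hp, ho _ _ (Ne.symm hk.2.1)]
    tauto
  · have := h.transfer i u j u k u hik hjk hlt
    simp only [Set.mem_insert_iff, Set.mem_singleton_iff, exists_eq_or_imp, exists_eq_left,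
      neg_holds, hr, hp, ha, ho _ _ hik]
    tauto
  · have := h.keep i u j u k u m u hij hik him hjk hjm hkm
    simp only [Set.mem_insert_iff, Set.mem_singleton_iff, exists_eq_or_imp, exists_eq_left,
      neg_holds, hr, ho _ _ hij, ho _ _ hjk, ho _ _ hjm]
    tauto
  · refine Totalizer.atMost_of_count_le (fun lo len s => ?_) ?_ C hC
    · have e : Totalizer.count (cardInput i j) τ lo len =
          Totalizer.count (cardInput i j) (mainAssignment lt p red a) lo len := by
        classical
        refine congrArg Finset.card (Finset.ext fun q => ?_)
        rw [Finset.mem_filter, Finset.mem_filter, hc]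
      rw [e, hτ, assignment, decide_eq_true_eq]
    · rw [count_cardInput]
      simp only [hr]
      exact h.degree i u j u hij

lemma satisfiable_iff {G : SimpleGraph (Fin n)} {d : ℕ} :
    (relEncoding G d).Satisfiable ↔ ∃ lt p red a, IsScheme G d Set.univ lt p red a :=
  ⟨fun ⟨_, h⟩ => ⟨_, _, _, _, isScheme_of_satisfied h⟩,
    fun ⟨_, _, _, _, h⟩ => ⟨_, satisfied_of_isScheme h⟩⟩

end RelEncoding

theorem mainTheorem3 :
    (∀ (n : ℕ) (_ : 1 ≤ n) (G : SimpleGraph (Fin n)) (d : ℕ),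
      (relEncoding G d).Satisfiable ↔ twinWidth G ≤ d) ∧
    (∃ (P : RAM.Prog) (B : Polynomial ℕ),
      ∀ (n : ℕ) (_ : 1 ≤ n) (G : SimpleGraph (Fin n)) (d : ℕ),
        ∃ (k : ℕ) (cs : List (List (Literal RelVar))),
          k ≤ B.eval (n + d) ∧ P.Computes (encodeInput G d) k (encodeCNF cs) ∧
          IsListingOf cs (relEncoding G d)) :=
  ⟨fun _ hn G d => by
    rw [RelEncoding.satisfiable_iff, twinWidth_le_iff hn, hasDSequence_iff_exists_scheme hn],
    exists_prog_relEncoding⟩
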